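/- Let $I\subseteq\mathbb R$ be an open interval and let $g:I\to\mathbb R$ be a smooth function that is nonlinear, i.e. not of the form $g(u)=au+b$ on $I$ with constants $a,b$. Consider the Klein–Gordon equation $u_{tx}=g(u)$ for functions $u(t,x)$ with values in $I$, and write $u_k=\partial_x^k u$. For $q\ge 1$ and an open set $V\subseteq\mathbb R\times\mathbb R^q$, a conservation law of pure $x$-derivative form of order $q$ over $V$ is a pair of smooth functions $P^t(x,u,u_1,\dots,u_q)$, $P^x(x,u,u_1,\dots,u_q)$, defined for $u\in I$ and $(x,u_1,\dots,u_q)\in V$, such that (1) $D_tP^t+D_xP^x=0$ holds on every smooth solution $u(t,x)$ of the equation, on any open set of the $(t,x)$-plane, whose jets $(x,u,u_1,\dots,u_q)$ stay in that domain; (2) the multiplier $\Lambda=\sum_{k=1}^{q}(-D_x)^{k-1}\,\partial P^t/\partial u_k$, where $D_x=\partial_x+u_1\partial_u+u_2\partial_{u_1}+\cdots$, has order exactly $2q-1$, i.e. $\partial\Lambda/\partial u_{2q-1}$ is not identically zero and $\Lambda$ depends on no $u_m$ with $m>2q-1$. If the equation $u_{tx}=g(u)$ admits a conservation law of pure $x$-derivative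 form of order $2$ over some open set $V$, then for every $q>1$ it admits a conservation law of pure $x$-derivative form of order $q$ over $V=\mathbb R\times\mathbb R^q$. In particular it is integrable in the sense of having infinitely many such conservation laws, of arbitrarily high order. -/

import Mathlib

open scoped ContDiff

noncomputable section

namespace KleinGordon

/-- A differential function of `x`, `u` and the `x`-derivatives of `u`: here `F x w` is the value at
the jet with base coordinate `x`, with `w 0 = u`, `w 1 = u_x`, `w 2 = u_xx`, and so on. -/
abbrev DiffFun : Type := ℝ → (ℕ → ℝ) → ℝ

/-- The partial derivative with respect to the jet coordinate `u_k = ∂ₓᵏ u`. -/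
def jetDeriv (k : ℕ) (F : DiffFun) : DiffFun := fun x w =>
  deriv (fun s => F x (Function.update w k s)) (w k)

/-- The total `x`-derivative `D_x = ∂_x + u_x ∂_u + u_xx ∂_{u_x} + ⋯`
(a finite sum, for a function of finitely many jet coordinates). -/
def totalDx (F : DiffFun) : DiffFun := fun x w =>
  deriv (fun y => F y w) x + ∑ᶠ k : ℕ, w (k + 1) * jetDeriv k F x w

/-- A function of `(x, u, u_x, …, ∂ₓ^q u)`, seen as a differential function. -/
def toDiffFun {q : ℕ} (P : ℝ × (Fin (q + 1) → ℝ) → ℝ) : DiffFun := fun x w =>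
  P (x, fun i => w i)

/-- The restricted Euler operator
`∂/∂u_x - D_x ∂/∂u_xx + ⋯ + (-D_x)^(q-1) ∂/∂(∂ₓ^q u)`, applied to a density
`P(x, u, …, ∂ₓ^q u)`. For a conserved density `P` it is the multiplier of the conservation law. -/
def multiplier {q : ℕ} (P : ℝ × (Fin (q + 1) → ℝ) → ℝ) : DiffFun := fun x w =>
  ∑ k ∈ Finset.range q, (fun F : DiffFun => -totalDx F)^[k] (jetDeriv (k + 1) (toDiffFun P)) x w

/-- The jets `(x, u, u_x, …, ∂ₓ^q u)` with `u ∈ I` and `(x, u_x, …, ∂ₓ^q u) ∈ V`. -/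
def jetDomain {q : ℕ} (I : Set ℝ) (V : Set (ℝ × (Fin q → ℝ))) : Set (ℝ × (Fin (q + 1) → ℝ)) :=
  {z | z.2 0 ∈ I ∧ (z.1, fun i : Fin q => z.2 i.succ) ∈ V}

/-- `F` has order exactly `p` over the jets that lie above `D`: it depends on `∂ₓᵖ u`
and on no higher `x`-derivative of `u`. -/
def HasOrderOn {q : ℕ} (D : Set (ℝ × (Fin (q + 1) → ℝ))) (F : DiffFun) (p : ℕ) : Prop :=
  (∃ x w, (x, fun i : Fin (q + 1) => w i) ∈ D ∧ jetDeriv p F x w ≠ 0) ∧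
    ∀ m, p < m → ∀ x w, (x, fun i : Fin (q + 1) => w i) ∈ D → jetDeriv m F x w = 0

/-- `u(t, x)` is a smooth solution of `u_tx = g(u)` on the open set `Ω` of the `(t, x)`-plane,
with values in `I`. -/
structure IsSolutionOn (g : ℝ → ℝ) (I : Set ℝ) (Ω : Set (ℝ × ℝ)) (u : ℝ × ℝ → ℝ) : Prop where
  isOpen : IsOpen Ω
  contDiffOn : ContDiffOn ℝ ∞ u Ω
  mapsTo : Set.MapsTo u Ω I
  eqn : ∀ t x, (t, x) ∈ Ω → deriv (fun s => deriv (fun y => u (s, y)) x) t = g (u (t, x))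

/-- The jet `(x, u, u_x, …, ∂ₓ^q u)` of the function `u` at the point `(t, x)`. -/
def xJet (q : ℕ) (u : ℝ × ℝ → ℝ) (t x : ℝ) : ℝ × (Fin (q + 1) → ℝ) :=
  (x, fun i => iteratedDeriv i (fun y => u (t, y)) x)

/-- `(Pt, Px)` is a conservation law of order `q` of `u_tx = g(u)`, `u ∈ I`, whose densities
are smooth functions of `(x, u, u_x, …, ∂ₓ^q u)` defined for `u ∈ I` and
`(x, u_x, …, ∂ₓ^q u) ∈ V`. -/
structure IsConservationLaw (g : ℝ → ℝ) (I : Set ℝ) (q : ℕ) (V : Set (ℝ × (Fin q → ℝ)))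
    (Pt Px : ℝ × (Fin (q + 1) → ℝ) → ℝ) : Prop where
  contDiffOn_Pt : ContDiffOn ℝ ∞ Pt (jetDomain I V)
  contDiffOn_Px : ContDiffOn ℝ ∞ Px (jetDomain I V)
  /-- `D_t Pt + D_x Px = 0` on all solutions `u(t, x)`. -/
  conserved : ∀ (Ω : Set (ℝ × ℝ)) (u : ℝ × ℝ → ℝ), IsSolutionOn g I Ω u →
    (∀ t x, (t, x) ∈ Ω → xJet q u t x ∈ jetDomain I V) →
    ∀ t x, (t, x) ∈ Ω →
      deriv (fun s => Pt (xJet q u s x)) t + deriv (fun y => Px (xJet q u t y)) x = 0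
  /-- The law is nontrivial of order exactly `q`: its multiplier has order `2q - 1`. -/
  order : ∃ p, p + 1 = 2 * q ∧ HasOrderOn (jetDomain I V) (multiplier Pt) p

end KleinGordon

end

/-! A law of order two forces `g'' = c g`. Testing it on the solutions `u = W(t (x + a))`, which
pass through every 2-jet with `u_x` and `u_xx` nonzero for all but two ratios `u_t / u_x`, gives
determining equations for `P^t` and `P^x`, and their differential consequences separate the
variable `u` from the others. Conversely, if `g'' = 4 k g`, the formal solution `y = ∑ yₙ μⁿ` of the
Riccati equation `y = μ (u_x - D_x y - k u_x y²)` has coefficients such that `u_x yₙ`, `n ≥ 2`, is a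
conserved density. Up to total `x`-derivatives, `u_x y_{2r+1}` is `± (∂ₓ^{r+1} u)²` plus a
polynomial of degree at most one in `∂ₓ^{r+1} u` and free of higher derivatives. -/

noncomputable section

namespace KleinGordon

section CoeffDeriv

open PowerSeries (coeff coeff_mk coeff_mul coeff_succ_X_mul)

variable {R A : Type*} [CommRing R] [CommRing A] [Algebra R A]

/-- A derivation of `A`, extended to power series over `A` by acting on the coefficients. -/
def coeffDeriv (d : Derivation R A A) : Derivation R (PowerSeries A) (PowerSeries A) :=
  Derivation.mk'
    { toFun f := PowerSeries.mk fun n => d (coeff n f)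
      map_add' f h := by ext n; simp
      map_smul' r f := by ext n; simp }
    fun f h => by
      ext n
      simp only [LinearMap.coe_mk, AddHom.coe_mk, coeff_mk, coeff_mul, map_add, map_sum,
        Derivation.leibniz, smul_eq_mul, Finset.sum_add_distrib]
      exact congrArg (_ + ·)
        (Finset.Nat.sum_antidiagonal_swap (f := fun ij => coeff ij.1 h * d (coeff ij.2 f)))

@[simp] lemma coeff_coeffDeriv (d : Derivation R A A) (f : PowerSeries A) (n : ℕ) :
    coeff n (coeffDeriv d f) = d (coeff n f) :=
  coeff_mk n fun n => d (coeff n f)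

lemma coeffDeriv_C (d : Derivation R A A) (a : A) :
    coeffDeriv d (PowerSeries.C a) = PowerSeries.C (d a) := by
  ext n
  simp only [coeff_coeffDeriv, PowerSeries.coeff_C]
  split_ifs <;> simp

@[simp] lemma coeffDeriv_X (d : Derivation R A A) : coeffDeriv d PowerSeries.X = 0 := by
  ext n
  simp only [coeff_coeffDeriv, PowerSeries.coeff_X]
  split_ifs <;> simp

lemma X_pow_dvd_coeffDeriv (d : Derivation R A A) {n : ℕ} {f : PowerSeries A}
    (hf : PowerSeries.X ^ n ∣ f) : PowerSeries.X ^ n ∣ coeffDeriv d f := by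
  rw [PowerSeries.X_pow_dvd_iff] at hf ⊢
  intro m hm
  rw [coeff_coeffDeriv, hf m hm, map_zero]

lemma eq_zero_of_forall_X_pow_dvd {f : PowerSeries A} (h : ∀ n, PowerSeries.X ^ n ∣ f) : f = 0 := by
  ext n
  exact PowerSeries.X_pow_dvd_iff.mp (h (n + 1)) n n.lt_succ_self

lemma eq_zero_of_eq_X_mul_coeffDeriv (d : Derivation R A A) {z₁ z₂ a₁ b₁ a₂ b₂ : PowerSeries A}
    (h₁ : z₁ = PowerSeries.X * (a₁ * z₁ + b₁ * z₂ - coeffDeriv d z₁))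
    (h₂ : z₂ = PowerSeries.X * (a₂ * z₁ + b₂ * z₂ - coeffDeriv d z₂)) : z₁ = 0 ∧ z₂ = 0 := by
  have hdvd : ∀ n, PowerSeries.X ^ n ∣ z₁ ∧ PowerSeries.X ^ n ∣ z₂ := by
    intro n
    induction n with
    | zero => simp
    | succ n ih =>
      have hlin (a b z : PowerSeries A) (hz : PowerSeries.X ^ n ∣ z) :
          PowerSeries.X ^ (n + 1) ∣ PowerSeries.X * (a * z₁ + b * z₂ - coeffDeriv d z) := by
        rw [pow_succ']
        exact mul_dvd_mul_left _ (dvd_sub (dvd_add (ih.1.mul_left a) (ih.2.mul_left b))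
          (X_pow_dvd_coeffDeriv d hz))
      exact ⟨h₁ ▸ hlin a₁ b₁ z₁ ih.1, h₂ ▸ hlin a₂ b₂ z₂ ih.2⟩
  exact ⟨eq_zero_of_forall_X_pow_dvd fun n => (hdvd n).1,
    eq_zero_of_forall_X_pow_dvd fun n => (hdvd n).2⟩

end CoeffDeriv

open MvPolynomial

section DifferentialPolynomials

variable {R : Type*} [CommRing R]

/-- Differential polynomials in `u_x, u_xx, …`; the variable `X i` stands for `∂ₓ^(i+1) u`. -/
abbrev DPoly (R : Type*) [CommRing R] : Type _ := MvPolynomial ℕ R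

/-- The total `x`-derivative on differential polynomials. -/
def totD : Derivation R (DPoly R) (DPoly R) := mkDerivation R fun i => X (i + 1)

@[simp] lemma totD_X (i : ℕ) : totD (X i : DPoly R) = X (i + 1) := mkDerivation_X _ _ _

/-- The total `x`-derivative of `F.1 * g(u) + F.2 * g'(u)` when `g'' = 4 k g`, again in terms of the
coefficients of `g(u)` and `g'(u)`. -/
def fluxD (k : R) (F : DPoly R × DPoly R) : DPoly R × DPoly R :=
  (totD F.1 + C (4 * k) * X 0 * F.2, totD F.2 + X 0 * F.1)

lemma fluxD_sub (k : R) (F G : DPoly R × DPoly R) :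
    fluxD k (F - G) = fluxD k F - fluxD k G := by
  ext1 <;> simp only [fluxD, Prod.fst_sub, Prod.snd_sub, map_sub] <;> ring

/-- The coefficients of `g(u)` and `g'(u)` in `∂ₜ ∂ₓ^(i+1) u = ∂ₓ^i g(u)` when `g'' = 4 k g`. -/
def evolCoeff (k : R) : ℕ → DPoly R × DPoly R
  | 0 => (1, 0)
  | i + 1 => fluxD k (evolCoeff k i)

/-- The total `t`-derivative along `u_tx = g(u)`, in terms of the coefficients of `g(u)` and
`g'(u)`, when `g'' = 4 k g`. -/
def evol (k : R) : Derivation R (DPoly R) (DPoly R × DPoly R) := mkDerivation R (evolCoeff k)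

@[simp] lemma evol_X (k : R) (i : ℕ) : evol k (X i) = evolCoeff k i := mkDerivation_X _ _ _

lemma evol_totD (k : R) (p : DPoly R) : evol k (totD p) = fluxD k (evol k p) := by
  induction p using MvPolynomial.induction_on with
  | C a => rw [derivation_C, derivation_C, map_zero]; ext1 <;> simp [fluxD]
  | add p q hp hq =>
    ext1 <;> simp only [map_add, hp, hq, fluxD, Prod.fst_add, Prod.snd_add] <;> ring
  | mul_X p i hp =>
    ext1 <;>
    · simp only [Derivation.leibniz, smul_eq_mul, totD_X, map_add, hp, evol_X, evolCoeff, fluxD,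
        Prod.fst_add, Prod.snd_add, Prod.smul_fst, Prod.smul_snd]
      ring

/-- The coefficient of `g(u)` in the total `t`-derivative. -/
def evolFst (k : R) : Derivation R (DPoly R) (DPoly R) := (LinearMap.fst _ _ _).compDer (evol k)

/-- The coefficient of `g'(u)` in the total `t`-derivative. -/
def evolSnd (k : R) : Derivation R (DPoly R) (DPoly R) := (LinearMap.snd _ _ _).compDer (evol k)

lemma evol_apply (k : R) (p : DPoly R) : evol k p = (evolFst k p, evolSnd k p) := rfl

lemma evolFst_totD (k : R) (p : DPoly R) :
    evolFst k (totD p) = totD (evolFst k p) + C (4 * k) * X 0 * evolSnd k p :=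
  congrArg Prod.fst (evol_totD k p)

lemma evolSnd_totD (k : R) (p : DPoly R) :
    evolSnd k (totD p) = totD (evolSnd k p) + X 0 * evolFst k p :=
  congrArg Prod.snd (evol_totD k p)

lemma evolFst_X_zero (k : R) : evolFst k (X 0) = 1 := congrArg Prod.fst (evol_X k 0)

lemma evolSnd_X_zero (k : R) : evolSnd k (X 0) = 0 := congrArg Prod.snd (evol_X k 0)

end DifferentialPolynomials

section Riccati

open Finset.HasAntidiagonal (antidiagonal mem_antidiagonal)

variable {R : Type*} [CommRing R]

/-- The coefficients of the formal solution `y = ∑ yₙ μⁿ` of the Riccati equation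
`y = μ (u_x - D_x y - k u_x y²)`. -/
def riccati (k : R) : ℕ → DPoly R
  | 0 => 0
  | n + 1 => (if n = 0 then X 0 else 0) - totD (riccati k n) -
      C k * X 0 * ∑ i : Fin (n + 1), riccati k i * riccati k (n - i)

lemma riccati_succ (k : R) (n : ℕ) :
    riccati k (n + 1) = (if n = 0 then X 0 else 0) - totD (riccati k n) -
      C k * X 0 * ∑ ij ∈ antidiagonal n, riccati k ij.1 * riccati k ij.2 := by
  rw [riccati, Finset.Nat.sum_antidiagonal_eq_sum_range_succ
    (fun i j => riccati k i * riccati k j), ← Fin.sum_univ_eq_sum_range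
    (fun i => riccati k i * riccati k (n - i))]

/-- The generating series of the `riccati` polynomials. -/
def riccatiSeries (k : R) : PowerSeries (DPoly R) := PowerSeries.mk (riccati k)

lemma riccatiSeries_eq (k : R) :
    riccatiSeries k = PowerSeries.X * (PowerSeries.C (X 0) - coeffDeriv totD (riccatiSeries k) -
      PowerSeries.C (C k) * PowerSeries.C (X 0) * riccatiSeries k ^ 2) := by
  ext1 n
  cases n with
  | zero => simp [riccatiSeries, riccati]
  | succ n =>
    rw [PowerSeries.coeff_succ_X_mul, riccatiSeries, PowerSeries.coeff_mk, riccati_succ, map_sub,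
      map_sub, ← map_mul, PowerSeries.coeff_C_mul, pow_two, PowerSeries.coeff_mul,
      PowerSeries.coeff_C]
    simp only [coeff_coeffDeriv, PowerSeries.coeff_mk]

lemma coeffDeriv_evolFst_totD (k : R) (f : PowerSeries (DPoly R)) :
    coeffDeriv (evolFst k) (coeffDeriv totD f) = coeffDeriv totD (coeffDeriv (evolFst k) f) +
      4 * PowerSeries.C (C k) * PowerSeries.C (X 0) * coeffDeriv (evolSnd k) f := by
  have h4 : (4 : PowerSeries (DPoly R)) = PowerSeries.C (C 4) := by simp only [map_ofNat]
  rw [h4, ← map_mul, ← map_mul, ← map_mul]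
  ext1 n
  simp only [coeff_coeffDeriv, map_add, PowerSeries.coeff_C_mul, evolFst_totD]

lemma coeffDeriv_evolSnd_totD (k : R) (f : PowerSeries (DPoly R)) :
    coeffDeriv (evolSnd k) (coeffDeriv totD f) = coeffDeriv totD (coeffDeriv (evolSnd k) f) +
      PowerSeries.C (X 0) * coeffDeriv (evolFst k) f := by
  ext1 n
  simp only [coeff_coeffDeriv, map_add, PowerSeries.coeff_C_mul, evolSnd_totD]

lemma evol_riccatiSeries (k : R) :
    coeffDeriv (evolFst k) (riccatiSeries k) =
        PowerSeries.X * (1 + PowerSeries.C (C k) * riccatiSeries k ^ 2) ∧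
      coeffDeriv (evolSnd k) (riccatiSeries k) = -(PowerSeries.X * riccatiSeries k) := by
  have hR := riccatiSeries_eq k
  set y := riccatiSeries k
  set μ : PowerSeries (DPoly R) := PowerSeries.X
  set v : PowerSeries (DPoly R) := PowerSeries.C (X 0)
  set κ : PowerSeries (DPoly R) := PowerSeries.C (C k)
  have hμ (d : Derivation R (DPoly R) (DPoly R)) : coeffDeriv d μ = 0 := coeffDeriv_X d
  have hκ (d : Derivation R (DPoly R) (DPoly R)) : coeffDeriv d κ = 0 := by
    rw [coeffDeriv_C, derivation_C, map_zero]
  have hv₁ : coeffDeriv (evolFst k) v = 1 := by rw [coeffDeriv_C, evolFst_X_zero, map_one]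
  have hv₂ : coeffDeriv (evolSnd k) v = 0 := by rw [coeffDeriv_C, evolSnd_X_zero, map_zero]
  have hR₁ := congrArg (coeffDeriv (evolFst k)) hR
  have hR₂ := congrArg (coeffDeriv (evolSnd k)) hR
  simp only [pow_two, Derivation.leibniz, map_sub, smul_eq_mul, hμ, hκ, hv₁, hv₂,
    coeffDeriv_evolFst_totD, coeffDeriv_evolSnd_totD] at hR₁ hR₂
  set y₁ := coeffDeriv (evolFst k) y
  set y₂ := coeffDeriv (evolSnd k) y
  -- The errors solve a homogeneous linear system with the contraction factor `μ`.
  obtain ⟨h₁, h₂⟩ := eq_zero_of_eq_X_mul_coeffDeriv totD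
    (z₁ := y₁ - μ * (1 + κ * y ^ 2)) (z₂ := y₂ + μ * y)
    (a₁ := -2 * κ * v * y) (b₁ := -4 * κ * v) (a₂ := -v) (b₂ := -2 * κ * v * y)
    (by
      simp only [pow_two, Derivation.leibniz, map_sub, map_add, smul_eq_mul, hμ, hκ,
        Derivation.map_one_eq_zero]
      linear_combination hR₁ - 2 * κ * μ * y * hR)
    (by
      simp only [Derivation.leibniz, map_add, smul_eq_mul, hμ]
      linear_combination hR₂ + μ * hR)
  exact ⟨sub_eq_zero.mp h₁, eq_neg_of_add_eq_zero_left h₂⟩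

lemma evolFst_riccati_succ (k : R) {n : ℕ} (hn : n ≠ 0) :
    evolFst k (riccati k (n + 1)) =
      C k * ∑ ij ∈ antidiagonal n, riccati k ij.1 * riccati k ij.2 := by
  have h := congrArg (PowerSeries.coeff (n + 1)) (evol_riccatiSeries k).1
  simpa only [coeff_coeffDeriv, PowerSeries.coeff_succ_X_mul, map_add, PowerSeries.coeff_C_mul,
    PowerSeries.coeff_one, if_neg hn, zero_add, pow_two, riccatiSeries, PowerSeries.coeff_mk,
    PowerSeries.coeff_mul _ (PowerSeries.mk _)] using h

lemma evolSnd_riccati_succ (k : R) (n : ℕ) :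
    evolSnd k (riccati k (n + 1)) = -riccati k n := by
  have h := congrArg (PowerSeries.coeff (n + 1)) (evol_riccatiSeries k).2
  simpa only [coeff_coeffDeriv, map_neg, PowerSeries.coeff_succ_X_mul, riccatiSeries,
    PowerSeries.coeff_mk] using h

lemma evol_X_zero_mul_riccati (k : R) {n : ℕ} (hn : n ≠ 0) :
    evol k (X 0 * riccati k (n + 1)) = fluxD k (-riccati k n, 0) := by
  rw [evol_apply, fluxD]
  simp only [Derivation.leibniz, smul_eq_mul, evolFst_X_zero, evolSnd_X_zero,
    evolFst_riccati_succ k hn, evolSnd_riccati_succ, map_neg, map_zero, mul_zero, add_zero,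
    mul_one, zero_add, mul_neg]
  rw [riccati_succ, if_neg hn]
  ext1 <;> ring

end Riccati

open scoped Pointwise

section Weight

variable {R : Type*} [CommRing R]

lemma exists_eq_single_add_of_ne_zero {σ : Type*} {m : σ →₀ ℕ} {i : σ} (hi : m i ≠ 0) :
    ∃ m', m = Finsupp.single i 1 + m' :=
  exists_add_of_le (Finsupp.single_le_iff.mpr (Nat.one_le_iff_ne_zero.mpr hi))

lemma totD_mem_restrictSupport {s t : Set (ℕ →₀ ℕ)}
    (hst : ∀ i m, Finsupp.single i 1 + m ∈ s → Finsupp.single (i + 1) 1 + m ∈ t) {p : DPoly R}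
    (hp : p ∈ restrictSupport R s) : totD p ∈ restrictSupport R t := by
  rw [restrictSupport_eq_span] at hp
  induction hp using Submodule.span_induction with
  | zero => rw [map_zero]; exact zero_mem _
  | add p q _ _ hp hq => rw [map_add]; exact add_mem hp hq
  | smul a p _ hp => rw [Derivation.map_smul]; exact Submodule.smul_mem _ a hp
  | mem p hp =>
    obtain ⟨m, hm, rfl⟩ := hp
    rw [totD, mkDerivation_monomial, one_smul]
    refine Submodule.sum_mem _ fun i hi => ?_
    obtain ⟨m', rfl⟩ := exists_eq_single_add_of_ne_zero (Finsupp.mem_support_iff.mp hi)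
    dsimp only
    rw [add_tsub_cancel_left, smul_eq_mul, X, monomial_mul, add_comm m',
      monomial_mem_restrictSupport]
    exact Or.inl (hst i m' hm)

/-- The weight of the variable `X i`, which stands for `∂ₓ^(i+1) u`: the number of derivatives. -/
abbrev jetWeight (i : ℕ) : ℕ := i + 1

/-- The exponents of weight `n` and of degree at least `d`. -/
def exponents (n d : ℕ) : Set (ℕ →₀ ℕ) := {m | Finsupp.weight jetWeight m = n ∧ d ≤ m.degree}

lemma single_add_mem_exponents {i n d : ℕ} {m : ℕ →₀ ℕ} :
    Finsupp.single i 1 + m ∈ exponents n d ↔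
      i + 1 + Finsupp.weight jetWeight m = n ∧ d ≤ m.degree + 1 := by
  simp [exponents, Finsupp.weight_single, add_comm]

lemma exponents_anti (n : ℕ) {d e : ℕ} (h : d ≤ e) : exponents n e ⊆ exponents n d :=
  fun _ hm => ⟨hm.1, h.trans hm.2⟩

lemma degree_le_weight_jetWeight (m : ℕ →₀ ℕ) : m.degree ≤ Finsupp.weight jetWeight m := by
  rw [Finsupp.degree_apply, Finsupp.weight_apply]
  exact Finset.sum_le_sum fun i _ => Nat.le_mul_of_pos_right _ i.succ_pos

lemma add_le_of_mem_exponents {i n d : ℕ} {m : ℕ →₀ ℕ} (hm : m ∈ exponents n d) (hi : m i ≠ 0) :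
    i + d ≤ n := by
  obtain ⟨m', rfl⟩ := exists_eq_single_add_of_ne_zero hi
  rw [single_add_mem_exponents] at hm
  have := degree_le_weight_jetWeight m'
  omega

lemma exponents_add_subset (n d n' d' : ℕ) :
    exponents n d + exponents n' d' ⊆ exponents (n + n') (d + d') := by
  rintro _ ⟨m, hm, m', hm', rfl⟩
  exact ⟨by rw [map_add, hm.1, hm'.1], by rw [map_add]; exact add_le_add hm.2 hm'.2⟩

lemma mul_mem_restrictSupport_exponents {n d n' d' : ℕ} {p p' : DPoly R}
    (hp : p ∈ restrictSupport R (exponents n d)) (hp' : p' ∈ restrictSupport R (exponents n' d')) :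
    p * p' ∈ restrictSupport R (exponents (n + n') (d + d')) :=
  restrictSupport_mono R (exponents_add_subset n d n' d')
    (restrictSupport_add R (exponents n d) (exponents n' d') ▸ Submodule.mul_mem_mul hp hp')

lemma X_mem_restrictSupport_exponents (i : ℕ) : X i ∈ restrictSupport R (exponents (i + 1) 1) :=
  (monomial_mem_restrictSupport R).mpr (Or.inl (by simp [exponents, Finsupp.weight_single]))

lemma totD_mem_restrictSupport_exponents {n d : ℕ} {p : DPoly R}
    (hp : p ∈ restrictSupport R (exponents n d)) :
    totD p ∈ restrictSupport R (exponents (n + 1) d) :=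
  totD_mem_restrictSupport (fun i m hm => by
    rw [single_add_mem_exponents] at hm ⊢
    omega) hp

end Weight

section LeadingTerm

open Finset.HasAntidiagonal (antidiagonal mem_antidiagonal)

variable {R : Type*} [CommRing R]

lemma C_mul_X_zero_mul_sum_mem (k : R) {n : ℕ} {y : ℕ → DPoly R}
    (hy : ∀ i ≤ n, y i ∈ restrictSupport R (exponents i 1)) :
    C k * X 0 * ∑ ij ∈ antidiagonal n, y ij.1 * y ij.2 ∈
      restrictSupport R (exponents (n + 1) 3) := by
  rw [mul_assoc, ← smul_eq_C_mul, add_comm n]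
  refine Submodule.smul_mem _ k (mul_mem_restrictSupport_exponents (d := 1) (d' := 2)
    (X_mem_restrictSupport_exponents 0) (Submodule.sum_mem _ fun ij hij => ?_))
  rw [mem_antidiagonal] at hij
  exact hij ▸ mul_mem_restrictSupport_exponents (hy _ (by omega)) (hy _ (by omega))

lemma riccati_mem_restrictSupport (k : R) (n : ℕ) :
    riccati k n ∈ restrictSupport R (exponents n 1) := by
  induction n using Nat.strong_induction_on with
  | _ n ih =>
    cases n with
    | zero => rw [riccati]; exact zero_mem _
    | succ n =>
      rw [riccati_succ]
      refine sub_mem (sub_mem ?_ (totD_mem_restrictSupport_exponents (ih n n.lt_succ_self)))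
        (restrictSupport_mono R (exponents_anti _ (by norm_num))
          (C_mul_X_zero_mul_sum_mem k fun i hi => ih i (Nat.lt_succ_of_le hi)))
      split_ifs with hn
      · subst hn; exact X_mem_restrictSupport_exponents 0
      · exact zero_mem _

lemma riccati_succ_sub_mem_restrictSupport (k : R) (n : ℕ) :
    riccati k (n + 1) - (-1) ^ n * X n ∈ restrictSupport R (exponents (n + 1) 3) := by
  have hquad (n : ℕ) := C_mul_X_zero_mul_sum_mem k (n := n)
    fun i _ => riccati_mem_restrictSupport k i
  induction n with
  | zero => simp [riccati_succ, riccati]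
  | succ n ih =>
    have hD : totD (riccati k (n + 1) - (-1) ^ n * X n) =
        totD (riccati k (n + 1)) - (-1) ^ n * X (n + 1) := by
      rw [map_sub, ← Int.cast_one, ← Int.cast_neg, ← Int.cast_pow, ← zsmul_eq_mul, map_zsmul,
        totD_X, zsmul_eq_mul]
    convert neg_mem (add_mem (totD_mem_restrictSupport_exponents ih) (hquad (n + 1))) using 1
    rw [hD, riccati_succ, if_neg n.succ_ne_zero]
    ring

/-- The differential polynomials that are total `x`-derivatives. -/
abbrev exactPolys (R : Type*) [CommRing R] : Submodule R (DPoly R) :=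
  LinearMap.range (totD (R := R)).toLinearMap

lemma X_mul_X_add_sub_mem_exactPolys (i n : ℕ) :
    X i * X (i + 2 * n) - (-1) ^ n * X (i + n) ^ 2 ∈ exactPolys R := by
  induction n generalizing i with
  | zero => simp [pow_two]
  | succ n ih =>
    have hD : totD (X i * X (i + 2 * n + 1) : DPoly R) =
        X (i + 1) * X (i + 1 + 2 * n) + X i * X (i + 2 * (n + 1)) := by
      rw [Derivation.leibniz, smul_eq_mul, smul_eq_mul, totD_X, totD_X]
      ring_nf
    convert sub_mem (LinearMap.mem_range_self _ (X i * X (i + 2 * n + 1))) (ih (i + 1)) using 1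
    rw [Derivation.coeFn_coe, hD, show i + (n + 1) = i + 1 + n by omega]
    ring

/-- The exponents of weight `2 q` and of degree at least `3` in the variables `X i`, `i < q + j`. -/
def cubicExponents (q j : ℕ) : Set (ℕ →₀ ℕ) :=
  {m | m ∈ exponents (2 * q) 3 ∧ ∀ i, m i ≠ 0 → i < q + j}

lemma mul_X_mem_restrictSupport_cubicExponents {q j : ℕ} {p : DPoly R}
    (hp : p ∈ restrictSupport R (exponents (q - j) 2)) (hj : j < q) :
    p * X (q + j - 1) ∈ restrictSupport R (cubicExponents q j) := by
  have hsub : exponents (q - j) 2 + {Finsupp.single (q + j - 1) 1} ⊆ cubicExponents q j := by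
    rintro _ ⟨m, hm, _, rfl, rfl⟩
    refine ⟨?_, fun i hi => ?_⟩
    · dsimp only
      rw [add_comm m, single_add_mem_exponents, hm.1]
      exact ⟨by omega, Nat.succ_le_succ hm.2⟩
    · by_contra! hlt
      have hmi : m i ≠ 0 := by simpa [Finsupp.single_apply, show q + j - 1 ≠ i by omega] using hi
      have := add_le_of_mem_exponents hm hmi
      omega
  refine restrictSupport_mono R hsub
    (restrictSupport_add R _ _ ▸ Submodule.mul_mem_mul hp ?_)
  exact (monomial_mem_restrictSupport R).mpr (Or.inl rfl)

lemma restrictSupport_cubicExponents_succ_le {q : ℕ} (j : ℕ) :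
    restrictSupport R (cubicExponents q (j + 1)) ≤
      restrictSupport R (cubicExponents q j) ⊔ exactPolys R := by
  rw [restrictSupport_eq_span, Submodule.span_le]
  rintro _ ⟨m, ⟨hm, hlt⟩, rfl⟩
  by_cases htop : m (q + j) = 0
  · refine Submodule.mem_sup_left ((monomial_mem_restrictSupport R).mpr
      (Or.inl ⟨hm, fun i hi => ?_⟩))
    have : i ≠ q + j := fun h => hi (h ▸ htop)
    have := hlt i hi
    omega
  · -- Integrate by parts: `m' X(q+j) = D (m' X(q+j-1)) - D m' X(q+j-1)`.
    obtain ⟨m', rfl⟩ := exists_eq_single_add_of_ne_zero htop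
    rw [single_add_mem_exponents] at hm
    have hm' : (monomial m' 1 : DPoly R) ∈ restrictSupport R (exponents (q - j - 1) 2) :=
      (monomial_mem_restrictSupport R).mpr (Or.inl ⟨by omega, by omega⟩)
    have hDm' := totD_mem_restrictSupport_exponents hm'
    rw [show q - j - 1 + 1 = q - j by omega] at hDm'
    have hD : (monomial (Finsupp.single (q + j) 1 + m') 1 : DPoly R) =
        -(totD (monomial m' 1) * X (q + j - 1)) + totD (monomial m' 1 * X (q + j - 1)) := by
      rw [Derivation.leibniz, totD_X, smul_eq_mul, smul_eq_mul,
        show q + j - 1 + 1 = q + j by omega, add_comm (Finsupp.single _ _),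
        ← mul_one (1 : R), ← monomial_mul, mul_one, ← X]
      ring
    dsimp only
    rw [SetLike.mem_coe, hD]
    exact Submodule.add_mem_sup
      (neg_mem (mul_X_mem_restrictSupport_cubicExponents hDm' (by omega)))
      (LinearMap.mem_range_self _ _)

lemma restrictSupport_exponents_le {q : ℕ} :
    restrictSupport R (exponents (2 * q) 3) ≤
      restrictSupport R (cubicExponents q 0) ⊔ exactPolys R := by
  have hred (j : ℕ) : restrictSupport R (cubicExponents q j) ≤
      restrictSupport R (cubicExponents q 0) ⊔ exactPolys R := by
    induction j with
    | zero => exact le_sup_left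
    | succ j ih =>
      exact (restrictSupport_cubicExponents_succ_le j).trans (sup_le ih le_sup_right)
  have hsub : exponents (2 * q) 3 ⊆ cubicExponents q q := fun m hm => ⟨hm, fun i hi => by
    have := add_le_of_mem_exponents hm hi
    omega⟩
  exact (restrictSupport_mono R hsub).trans (hred q)

lemma pderiv_pderiv_eq_zero_of_mem_restrictSupport {σ : Type*} {s : Set (σ →₀ ℕ)} {i : σ}
    (hs : ∀ m ∈ s, m i ≤ 1) {p : MvPolynomial σ R} (hp : p ∈ restrictSupport R s) :
    pderiv i (pderiv i p) = 0 := by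
  ext m
  have hm : m + Finsupp.single i 1 + Finsupp.single i 1 ∉ p.support := fun h => by
    have := hs _ ((mem_restrictSupport_iff R).mp hp h)
    simp at this
  rw [coeff_pderiv, coeff_pderiv, notMem_support_iff.mp hm, zero_mul, zero_mul, coeff_zero]

lemma le_one_of_mem_cubicExponents {r : ℕ} {m : ℕ →₀ ℕ} (hm : m ∈ cubicExponents (r + 1) 0) :
    m r ≤ 1 := by
  by_contra! hr
  obtain ⟨m', rfl⟩ := exists_eq_single_add_of_ne_zero (by omega : m r ≠ 0)
  have hm' : m' ∈ exponents (r + 1) 2 := by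
    obtain ⟨hw, hd⟩ := single_add_mem_exponents.mp hm.1
    exact ⟨by omega, by omega⟩
  rw [Finsupp.add_apply, Finsupp.single_eq_same] at hr
  have := add_le_of_mem_exponents hm' (i := r) (by omega)
  omega

lemma exists_density_sub_mem_exactPolys (k : R) (r : ℕ) :
    ∃ p ∈ restrictSupport R (cubicExponents (r + 1) 0),
      X 0 * riccati k (2 * r + 1) - ((-1) ^ r * X r ^ 2 + p) ∈ exactPolys R := by
  have hcubic : X 0 * (riccati k (2 * r + 1) - X (2 * r)) ∈
      restrictSupport R (exponents (2 * (r + 1)) 3) := by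
    have h := riccati_succ_sub_mem_restrictSupport k (2 * r)
    rw [pow_mul, neg_one_sq, one_pow, one_mul] at h
    have := mul_mem_restrictSupport_exponents (X_mem_restrictSupport_exponents 0) h
    rw [show 0 + 1 + (2 * r + 1) = 2 * (r + 1) by omega] at this
    exact restrictSupport_mono R (exponents_anti _ (by norm_num)) this
  obtain ⟨p, hp, e, he, hpe⟩ := Submodule.mem_sup.mp (restrictSupport_exponents_le hcubic)
  have hquad := X_mul_X_add_sub_mem_exactPolys (R := R) 0 r
  rw [zero_add, zero_add] at hquad
  refine ⟨p, hp, ?_⟩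
  convert add_mem he hquad using 1
  linear_combination -hpe

end LeadingTerm

section Order

variable {R : Type*} [CommRing R]

lemma derivation_mem_supported {σ : Type*} {s t : Set σ} (hst : s ⊆ t)
    (d : Derivation R (MvPolynomial σ R) (MvPolynomial σ R))
    (hd : ∀ i ∈ s, d (X i) ∈ supported R t) {p : MvPolynomial σ R} (hp : p ∈ supported R s) :
    d p ∈ supported R t := by
  induction hp using Algebra.adjoin_induction with
  | mem x hx => obtain ⟨i, hi, rfl⟩ := hx; exact hd i hi
  | algebraMap a => rw [Derivation.map_algebraMap]; exact zero_mem _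
  | add p q _ _ hp hq => rw [map_add]; exact add_mem hp hq
  | mul p q hp hq hdp hdq =>
    rw [Derivation.leibniz]
    exact add_mem (mul_mem (supported_mono hst hp) hdq) (mul_mem (supported_mono hst hq) hdp)

lemma X_mem_supported_Iio {i n : ℕ} (h : i < n) : (X i : DPoly R) ∈ supported R (Set.Iio n) :=
  Algebra.subset_adjoin (Set.mem_image_of_mem X h)

lemma totD_mem_supported {n : ℕ} {p : DPoly R} (hp : p ∈ supported R (Set.Iio n)) :
    totD p ∈ supported R (Set.Iio (n + 1)) :=
  derivation_mem_supported (Set.Iio_subset_Iio n.le_succ) totD (fun i hi => by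
    rw [totD_X]
    exact X_mem_supported_Iio (Nat.succ_lt_succ hi)) hp

lemma evolCoeff_mem_supported (k : R) (i : ℕ) :
    (evolCoeff k i).1 ∈ supported R (Set.Iio i) ∧ (evolCoeff k i).2 ∈ supported R (Set.Iio i) := by
  induction i with
  | zero => exact ⟨one_mem _, zero_mem _⟩
  | succ i ih =>
    have hX := X_mem_supported_Iio (R := R) i.succ_pos
    have hle := supported_mono (R := R) (Set.Iio_subset_Iio i.le_succ)
    exact ⟨add_mem (totD_mem_supported ih.1)
        (mul_mem (mul_mem (algebraMap_mem _ (4 * k)) hX) (hle ih.2)),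
      add_mem (totD_mem_supported ih.2) (mul_mem hX (hle ih.1))⟩

lemma evol_mem_supported (k : R) {n : ℕ} {p : DPoly R} (hp : p ∈ supported R (Set.Iio n)) :
    (evol k p).1 ∈ supported R (Set.Iio n) ∧ (evol k p).2 ∈ supported R (Set.Iio n) := by
  have hcoeff (i : ℕ) (hi : i ∈ Set.Iio n) :
      (evol k (X i)).1 ∈ supported R (Set.Iio n) ∧ (evol k (X i)).2 ∈ supported R (Set.Iio n) := by
    have hle := supported_mono (R := R) (Set.Iio_subset_Iio (Set.mem_Iio.mp hi).le)
    rw [evol_X]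
    exact (evolCoeff_mem_supported k i).imp (@hle _) (@hle _)
  exact ⟨derivation_mem_supported subset_rfl (evolFst k) (fun i hi => (hcoeff i hi).1) hp,
    derivation_mem_supported subset_rfl (evolSnd k) (fun i hi => (hcoeff i hi).2) hp⟩

lemma restrictSupport_le_supported {σ : Type*} {s : Set (σ →₀ ℕ)} {t : Set σ}
    (hst : ∀ m ∈ s, ∀ i, m i ≠ 0 → i ∈ t) {p : MvPolynomial σ R} (hp : p ∈ restrictSupport R s) :
    p ∈ supported R t := by
  rw [mem_supported]
  intro i hi
  obtain ⟨m, hm, him⟩ := (mem_vars_iff_mem_support i).mp hi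
  exact hst m ((mem_restrictSupport_iff R).mp hp hm) i (Finsupp.mem_support_iff.mp him)

lemma notMem_vars_of_pderiv_eq_zero [NoZeroDivisors R] [CharZero R] {σ : Type*}
    {p : MvPolynomial σ R} {i : σ} (h : pderiv i p = 0) : i ∉ p.vars := by
  intro hi
  obtain ⟨m, hm, him⟩ := (mem_vars_iff_mem_support i).mp hi
  obtain ⟨m', rfl⟩ := exists_eq_single_add_of_ne_zero (Finsupp.mem_support_iff.mp him)
  have hcoeff := congrArg (coeff m') h
  rw [coeff_pderiv, coeff_zero, add_comm m', mul_eq_zero] at hcoeff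
  exact hcoeff.elim (mem_support_iff.mp hm) (Nat.cast_add_one_ne_zero _)

lemma pderiv_eq_zero_of_mem_supported {n : ℕ} {p : DPoly R} (hp : p ∈ supported R (Set.Iio n)) :
    pderiv n p = 0 :=
  pderiv_eq_zero_of_notMem_vars fun h => lt_irrefl n (mem_supported.mp hp h)

lemma mem_supported_of_pderiv_eq_zero [NoZeroDivisors R] [CharZero R] {n : ℕ} {p : DPoly R}
    (hp : p ∈ supported R (Set.Iio (n + 1))) (h : pderiv n p = 0) :
    p ∈ supported R (Set.Iio n) := by
  rw [mem_supported] at hp ⊢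
  intro i hi
  have hne : i ≠ n := by
    rintro rfl
    exact notMem_vars_of_pderiv_eq_zero h hi
  exact lt_of_le_of_ne (Nat.lt_succ_iff.mp (hp hi)) hne

lemma pderiv_succ_totD (i : ℕ) (p : DPoly R) :
    pderiv (i + 1) (totD p) = totD (pderiv (i + 1) p) + pderiv i p := by
  classical
  have hcomm : ⁅pderiv (R := R) (i + 1), totD (R := R)⁆ = pderiv (R := R) i := by
    ext1 j
    rw [Derivation.commutator_apply, totD_X, pderiv_X, pderiv_X, pderiv_X]
    simp only [Pi.single_apply, add_left_inj]
    split_ifs <;> simp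
  rw [← hcomm, Derivation.commutator_apply, add_sub_cancel]

lemma pderiv_succ_fluxD (k : R) {n : ℕ} {F : DPoly R × DPoly R}
    (h₁ : F.1 ∈ supported R (Set.Iio (n + 1))) (h₂ : F.2 ∈ supported R (Set.Iio (n + 1))) :
    pderiv (n + 1) (fluxD k F).1 = pderiv n F.1 ∧ pderiv (n + 1) (fluxD k F).2 = pderiv n F.2 := by
  have hX : pderiv (n + 1) (X 0 : DPoly R) = 0 := pderiv_X_of_ne n.succ_ne_zero.symm
  simp [fluxD, pderiv_succ_totD, Derivation.leibniz, hX, pderiv_eq_zero_of_mem_supported h₁,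
    pderiv_eq_zero_of_mem_supported h₂]

lemma mem_supported_of_fluxD_mem_supported [NoZeroDivisors R] [CharZero R] (k : R) {n : ℕ}
    {F : DPoly R × DPoly R} (hD₁ : (fluxD k F).1 ∈ supported R (Set.Iio n))
    (hD₂ : (fluxD k F).2 ∈ supported R (Set.Iio n)) :
    F.1 ∈ supported R (Set.Iio n) ∧ F.2 ∈ supported R (Set.Iio n) := by
  have hlower (N : ℕ) (hN₁ : F.1 ∈ supported R (Set.Iio (n + N)))
      (hN₂ : F.2 ∈ supported R (Set.Iio (n + N))) :
      F.1 ∈ supported R (Set.Iio n) ∧ F.2 ∈ supported R (Set.Iio n) := by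
    induction N with
    | zero => exact ⟨hN₁, hN₂⟩
    | succ N ih =>
      have hle := supported_mono (R := R) (Set.Iio_subset_Iio (by omega : n ≤ n + N + 1))
      obtain ⟨h₁, h₂⟩ := pderiv_succ_fluxD k (n := n + N) hN₁ hN₂
      rw [pderiv_eq_zero_of_mem_supported (hle hD₁)] at h₁
      rw [pderiv_eq_zero_of_mem_supported (hle hD₂)] at h₂
      exact ih (mem_supported_of_pderiv_eq_zero hN₁ h₁.symm)
        (mem_supported_of_pderiv_eq_zero hN₂ h₂.symm)
  obtain ⟨N, hN⟩ := (F.1.vars ∪ F.2.vars).exists_nat_subset_range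
  refine hlower N (mem_supported.mpr fun i hi => ?_) (mem_supported.mpr fun i hi => ?_)
  · have := Finset.mem_range.mp (hN (Finset.mem_union_left _ hi))
    exact Set.mem_Iio.mpr (by omega)
  · have := Finset.mem_range.mp (hN (Finset.mem_union_right _ hi))
    exact Set.mem_Iio.mpr (by omega)

end Order

section ConservedDensity

variable {R : Type*} [CommRing R]

lemma pderiv_pderiv_density {r : ℕ} {p : DPoly R}
    (hp : p ∈ restrictSupport R (cubicExponents (r + 1) 0)) :
    pderiv r (pderiv r ((-1) ^ r * X r ^ 2 + p)) = C (2 * (-1) ^ r) := by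
  have hC : (-1 : DPoly R) ^ r = C ((-1) ^ r) := by simp
  have hX : pderiv r (X r ^ 2 : DPoly R) = C 2 * X r := by
    simp [map_ofNat (C : R →+* DPoly R)]
  rw [hC, map_add, map_add, pderiv_pderiv_eq_zero_of_mem_restrictSupport
    (fun m => le_one_of_mem_cubicExponents) hp, add_zero, pderiv_C_mul, hX,
    pderiv_C_mul, pderiv_C_mul, pderiv_X_self, mul_one, ← map_mul, mul_comm]

/-- When `g'' = 4 k g`, the equation `u_tx = g(u)` has a polynomial conserved density of every order
`r + 1 > 1` that is quadratic in the highest derivative. -/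
theorem exists_conserved_density [NoZeroDivisors R] [CharZero R] (k : R) {r : ℕ} (hr : r ≠ 0) :
    ∃ (p : DPoly R) (F : DPoly R × DPoly R), p ∈ supported R (Set.Iio (r + 1)) ∧
      F.1 ∈ supported R (Set.Iio (r + 1)) ∧ F.2 ∈ supported R (Set.Iio (r + 1)) ∧
      evol k p = fluxD k F ∧ pderiv r (pderiv r p) = C (2 * (-1) ^ r) := by
  obtain ⟨p, hp, e, he⟩ := exists_density_sub_mem_exactPolys k r
  set P : DPoly R := (-1) ^ r * X r ^ 2 + p
  set F : DPoly R × DPoly R := (-riccati k (2 * r), 0) - evol k e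
  have hP : P ∈ supported R (Set.Iio (r + 1)) :=
    add_mem (mul_mem (pow_mem (neg_mem (one_mem _)) r)
        (pow_mem (X_mem_supported_Iio r.lt_succ_self) 2))
      (restrictSupport_le_supported (fun m hm => hm.2) hp)
  have hevol : evol k P = fluxD k F := by
    rw [fluxD_sub, ← evol_X_zero_mul_riccati k (by omega : 2 * r ≠ 0), ← evol_totD, ← map_sub]
    exact congrArg (evol k) (eq_sub_of_add_eq' (eq_add_of_sub_eq he.symm).symm)
  obtain ⟨hD₁, hD₂⟩ := evol_mem_supported k hP
  rw [hevol] at hD₁ hD₂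
  obtain ⟨hF₁, hF₂⟩ := mem_supported_of_fluxD_mem_supported k hD₁ hD₂
  exact ⟨P, F, hP, hF₁, hF₂, hevol, pderiv_pderiv_density hp⟩

end ConservedDensity

section JetDependence

/-- `F` depends only on `x` and on the jet coordinates `u_i` with `i < n`. -/
def DependsOnLT (n : ℕ) (F : DiffFun) : Prop :=
  ∀ x w w', (∀ i < n, w i = w' i) → F x w = F x w'

variable {F G : DiffFun} {m n : ℕ}

lemma DependsOnLT.mono (hF : DependsOnLT m F) (h : m ≤ n) : DependsOnLT n F :=
  fun x w w' hw => hF x w w' fun i hi => hw i (hi.trans_le h)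

lemma DependsOnLT.apply_update (hF : DependsOnLT n F) {k : ℕ} (hk : n ≤ k) (x : ℝ) (w : ℕ → ℝ)
    (s : ℝ) : F x (Function.update w k s) = F x w :=
  hF x _ _ fun _ hi => Function.update_of_ne (hi.trans_le hk).ne _ _

lemma DependsOnLT.jetDeriv_eq_zero (hF : DependsOnLT n F) {k : ℕ} (hk : n ≤ k) :
    jetDeriv k F = 0 := by
  ext x w
  simp only [jetDeriv, hF.apply_update hk, deriv_const, Pi.zero_apply]

protected lemma DependsOnLT.jetDeriv (hF : DependsOnLT n F) (k : ℕ) :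
    DependsOnLT n (jetDeriv k F) := by
  intro x w w' hw
  obtain hk | hk := lt_or_ge k n
  · rw [jetDeriv, jetDeriv, hw k hk]
    congr 1
    ext s
    refine hF x _ _ fun i hi => ?_
    rcases eq_or_ne i k with rfl | hik
    · rw [Function.update_self, Function.update_self]
    · rw [Function.update_of_ne hik, Function.update_of_ne hik, hw i hi]
  · rw [hF.jetDeriv_eq_zero hk, Pi.zero_apply, Pi.zero_apply, Pi.zero_apply]

lemma DependsOnLT.totalDx_apply (hF : DependsOnLT n F) (x : ℝ) (w : ℕ → ℝ) :
    totalDx F x w =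
      deriv (fun y => F y w) x +
        ∑ k ∈ Finset.range n, w (k + 1) * jetDeriv k F x w := by
  rw [totalDx, finsum_eq_sum_of_support_subset]
  intro k hk
  by_contra hkn
  rw [Finset.coe_range, Set.mem_Iio, not_lt] at hkn
  rw [Function.mem_support, hF.jetDeriv_eq_zero hkn, Pi.zero_apply, Pi.zero_apply, mul_zero] at hk
  exact hk rfl

protected lemma DependsOnLT.totalDx (hF : DependsOnLT n F) : DependsOnLT (n + 1) (totalDx F) := by
  intro x w w' hw
  have hw' : ∀ i < n, w i = w' i := fun i hi => hw i (hi.trans n.lt_succ_self)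
  rw [hF.totalDx_apply, hF.totalDx_apply, funext fun y => hF y w w' hw']
  refine congrArg _ (Finset.sum_congr rfl fun k hk => ?_)
  rw [hw (k + 1) (Nat.succ_lt_succ (Finset.mem_range.mp hk)), hF.jetDeriv k x w w' hw']

lemma DependsOnLT.neg (hF : DependsOnLT n F) : DependsOnLT n (-F) :=
  fun x w w' hw => congrArg Neg.neg (hF x w w' hw)

lemma dependsOnLT_sum {ι : Type*} {s : Finset ι} {F : ι → DiffFun}
    (h : ∀ i ∈ s, DependsOnLT n (F i)) : DependsOnLT n (∑ i ∈ s, F i) := by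
  intro x w w' hw
  simp only [Finset.sum_apply]
  exact Finset.sum_congr rfl fun i hi => h i hi x w w' hw

lemma jetDeriv_neg (k : ℕ) (F : DiffFun) : jetDeriv k (-F) = -jetDeriv k F := by
  ext x w
  exact deriv.fun_neg

lemma jetDeriv_add_of_dependsOnLT (hF : DependsOnLT n F) {k : ℕ} (hk : n ≤ k) (G : DiffFun) :
    jetDeriv k (F + G) = jetDeriv k G := by
  ext x w
  simp only [jetDeriv, Pi.add_apply, hF.apply_update hk, deriv_const_add]

lemma DependsOnLT.jetDeriv_succ_totalDx (hF : DependsOnLT (n + 1) F) :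
    jetDeriv (n + 1) (totalDx F) = jetDeriv n F := by
  ext x w
  have h (s : ℝ) : totalDx F x (Function.update w (n + 1) s) =
      (deriv (fun y => F y w) x + ∑ k ∈ Finset.range n, w (k + 1) * jetDeriv k F x w) +
        s * jetDeriv n F x w := by
    have hne {k : ℕ} (hk : k ∈ Finset.range n) : k + 1 ≠ n + 1 := by
      have := Finset.mem_range.mp hk
      omega
    simp only [hF.totalDx_apply, Finset.sum_range_succ, hF.apply_update le_rfl,
      (hF.jetDeriv _).apply_update le_rfl, Function.update_self, ← add_assoc]
    rw [Finset.sum_congr rfl fun k hk => by rw [Function.update_of_ne (hne hk)]]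
  rw [jetDeriv, funext h, deriv_const_add, deriv_mul_const_field, deriv_id'', one_mul]

lemma DependsOnLT.iterate_neg_totalDx (hF : DependsOnLT n F) (k : ℕ) :
    DependsOnLT (n + k) ((fun F : DiffFun => -totalDx F)^[k] F) := by
  induction k with
  | zero => exact hF
  | succ k ih =>
    rw [Function.iterate_succ_apply']
    exact ih.totalDx.neg

lemma DependsOnLT.jetDeriv_iterate_neg_totalDx (hF : DependsOnLT (n + 1) F) (k : ℕ) :
    jetDeriv (n + k) ((fun F : DiffFun => -totalDx F)^[k] F) =
      (-1) ^ k * jetDeriv n F := by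
  induction k with
  | zero => rw [pow_zero, one_mul]; rfl
  | succ k ih =>
    have hk := hF.iterate_neg_totalDx k
    rw [add_right_comm] at hk
    rw [Function.iterate_succ_apply', jetDeriv_neg, ← add_assoc, hk.jetDeriv_succ_totalDx, ih]
    ring

end JetDependence

section Multiplier

variable {q : ℕ}

lemma dependsOnLT_toDiffFun (P : ℝ × (Fin (q + 1) → ℝ) → ℝ) : DependsOnLT (q + 1) (toDiffFun P) :=
  fun _ _ _ hw => congrArg P (Prod.ext rfl (funext fun i => hw i i.isLt))

lemma multiplier_eq_sum (P : ℝ × (Fin (q + 1) → ℝ) → ℝ) :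
    multiplier P = ∑ k ∈ Finset.range q,
      (fun F : DiffFun => -totalDx F)^[k] (jetDeriv (k + 1) (toDiffFun P)) := by
  ext x w
  rw [multiplier, Finset.sum_apply, Finset.sum_apply]

lemma dependsOnLT_sum_range_iterate (P : ℝ × (Fin (q + 1) → ℝ) → ℝ) (r : ℕ) :
    DependsOnLT (q + r) (∑ k ∈ Finset.range r,
      (fun F : DiffFun => -totalDx F)^[k] (jetDeriv (k + 1) (toDiffFun P))) :=
  dependsOnLT_sum fun k hk =>
    (((dependsOnLT_toDiffFun P).jetDeriv (k + 1)).iterate_neg_totalDx k).mono (by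
      have := Finset.mem_range.mp hk
      omega)

lemma dependsOnLT_multiplier (P : ℝ × (Fin (q + 1) → ℝ) → ℝ) :
    DependsOnLT (q + q) (multiplier P) :=
  multiplier_eq_sum P ▸ dependsOnLT_sum_range_iterate P q

lemma jetDeriv_multiplier {r : ℕ} (P : ℝ × (Fin (r + 1 + 1) → ℝ) → ℝ) :
    jetDeriv (r + 1 + r) (multiplier P) =
      (-1) ^ r * jetDeriv (r + 1) (jetDeriv (r + 1) (toDiffFun P)) := by
  rw [multiplier_eq_sum, Finset.sum_range_succ,
    jetDeriv_add_of_dependsOnLT (dependsOnLT_sum_range_iterate P r) le_rfl,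
    ((dependsOnLT_toDiffFun P).jetDeriv (r + 1)).jetDeriv_iterate_neg_totalDx]

lemma hasOrderOn_multiplier_iff {r : ℕ} {D : Set (ℝ × (Fin (r + 1 + 1) → ℝ))}
    (P : ℝ × (Fin (r + 1 + 1) → ℝ) → ℝ) :
    HasOrderOn D (multiplier P) (r + 1 + r) ↔ ∃ x w, (x, fun i : Fin (r + 1 + 1) => w i) ∈ D ∧
      jetDeriv (r + 1) (jetDeriv (r + 1) (toDiffFun P)) x w ≠ 0 := by
  have hhigh (m : ℕ) (hm : r + 1 + r < m) : jetDeriv m (multiplier P) = 0 :=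
    (dependsOnLT_multiplier P).jetDeriv_eq_zero (by omega)
  have hsign (x : ℝ) (w : ℕ → ℝ) : ((-1) ^ r : DiffFun) x w ≠ 0 := by simp
  rw [HasOrderOn, jetDeriv_multiplier, and_iff_left fun m hm x w _ => by rw [hhigh m hm]; rfl]
  simp only [Pi.mul_apply, mul_ne_zero_iff, hsign, ne_eq, not_false_eq_true, true_and]

end Multiplier

section PartialDerivatives

variable {E : Type*} [NormedAddCommGroup E] [NormedSpace ℝ E] {D : Set E} {F : E → ℝ}

lemma differentiableAt_of_contDiffOn (hD : IsOpen D) (hF : ContDiffOn ℝ ∞ F D) {z : E}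
    (hz : z ∈ D) : DifferentiableAt ℝ F z :=
  (hF.contDiffAt (hD.mem_nhds hz)).differentiableAt (by simp)

lemma contDiffOn_fderiv_apply (hD : IsOpen D) (hF : ContDiffOn ℝ ∞ F D) (v : E) :
    ContDiffOn ℝ ∞ (fun z => fderiv ℝ F z v) D :=
  (hF.fderiv_of_isOpen hD (m := ∞) (by simp)).clm_apply contDiffOn_const

lemma fderiv_fderiv_apply_comm (hD : IsOpen D) (hF : ContDiffOn ℝ ∞ F D) {z : E} (hz : z ∈ D)
    (v w : E) :
    fderiv ℝ (fun z => fderiv ℝ F z v) z w = fderiv ℝ (fun z => fderiv ℝ F z w) z v := by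
  have hat : ContDiffAt ℝ ∞ F z := hF.contDiffAt (hD.mem_nhds hz)
  have hd : DifferentiableAt ℝ (fderiv ℝ F) z :=
    (hat.fderiv_right (m := ∞) (by simp)).differentiableAt (by simp)
  have hsymm := hat.isSymmSndFDerivAt (by
    rw [minSmoothness_of_isRCLikeNormedField]
    exact WithTop.coe_le_coe.2 (le_top (a := (2 : ℕ∞))))
  have happly (v w : E) : fderiv ℝ (fun z => fderiv ℝ F z v) z w = fderiv ℝ (fderiv ℝ F) z w v := by
    rw [fderiv_clm_apply hd (differentiableAt_const v)]
    simp
  rw [happly, happly]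
  exact hsymm w v

variable {Ω : Set (ℝ × ℝ)} {f : ℝ × ℝ → ℝ} {t x : ℝ}

lemma hasDerivAt_snd_of_differentiableAt (hf : DifferentiableAt ℝ f (t, x)) :
    HasDerivAt (fun y => f (t, y)) (fderiv ℝ f (t, x) (0, 1)) x :=
  hf.hasFDerivAt.comp_hasDerivAt x ((hasDerivAt_const x t).prodMk (hasDerivAt_id x))

lemma hasDerivAt_fst_of_differentiableAt (hf : DifferentiableAt ℝ f (t, x)) :
    HasDerivAt (fun s => f (s, x)) (fderiv ℝ f (t, x) (1, 0)) t :=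
  hf.hasFDerivAt.comp_hasDerivAt t ((hasDerivAt_id t).prodMk (hasDerivAt_const t x))

lemma eventually_fst_mem (hΩ : IsOpen Ω) (htx : (t, x) ∈ Ω) : ∀ᶠ s in nhds t, (s, x) ∈ Ω :=
  (Continuous.prodMk_left x).continuousAt.eventually (hΩ.mem_nhds htx)

lemma eventually_snd_mem (hΩ : IsOpen Ω) (htx : (t, x) ∈ Ω) : ∀ᶠ y in nhds x, (t, y) ∈ Ω :=
  (Continuous.prodMk_right t).continuousAt.eventually (hΩ.mem_nhds htx)

lemma hasDerivAt_deriv_swap (hΩ : IsOpen Ω) (hf : ContDiffOn ℝ ∞ f Ω) {G : ℝ × ℝ → ℝ} {G' : ℝ}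
    (hG : ∀ z ∈ Ω, HasDerivAt (fun s => f (s, z.2)) (G z) z.1) (htx : (t, x) ∈ Ω)
    (hG' : HasDerivAt (fun y => G (t, y)) G' x) :
    HasDerivAt (fun s => deriv (fun y => f (s, y)) x) G' t := by
  have hd {z : ℝ × ℝ} (hz : z ∈ Ω) : DifferentiableAt ℝ f z :=
    differentiableAt_of_contDiffOn hΩ hf hz
  have hd' (v : ℝ × ℝ) : DifferentiableAt ℝ (fun z => fderiv ℝ f z v) (t, x) :=
    differentiableAt_of_contDiffOn hΩ (contDiffOn_fderiv_apply hΩ hf v) htx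
  have hfx : (fun s => deriv (fun y => f (s, y)) x) =ᶠ[nhds t]
      fun s => fderiv ℝ f (s, x) (0, 1) := by
    filter_upwards [eventually_fst_mem hΩ htx] with s hs
    exact (hasDerivAt_snd_of_differentiableAt (hd hs)).deriv
  have hft : (fun y => G (t, y)) =ᶠ[nhds x] fun y => fderiv ℝ f (t, y) (1, 0) := by
    filter_upwards [eventually_snd_mem hΩ htx] with y hy
    exact (hG _ hy).unique (hasDerivAt_fst_of_differentiableAt (hd hy))
  have hGeq : G' = fderiv ℝ (fun z => fderiv ℝ f z (0, 1)) (t, x) (1, 0) := by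
    rw [fderiv_fderiv_apply_comm hΩ hf htx]
    exact hG'.unique ((hasDerivAt_snd_of_differentiableAt (hd' _)).congr_of_eventuallyEq hft)
  rw [hGeq]
  exact (hasDerivAt_fst_of_differentiableAt (hd' _)).congr_of_eventuallyEq hfx

/-- The derivative `∂ₓᵏ u`. -/
def xDeriv (u : ℝ × ℝ → ℝ) (k : ℕ) (z : ℝ × ℝ) : ℝ := iteratedDeriv k (fun y => u (z.1, y)) z.2

lemma xDeriv_zero (u : ℝ × ℝ → ℝ) : xDeriv u 0 = u := by
  ext z
  rw [xDeriv, iteratedDeriv_zero]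

lemma xDeriv_succ (u : ℝ × ℝ → ℝ) (k : ℕ) (z : ℝ × ℝ) :
    xDeriv u (k + 1) z = deriv (fun y => xDeriv u k (z.1, y)) z.2 := by
  simp only [xDeriv, iteratedDeriv_succ]

variable {u : ℝ × ℝ → ℝ}

lemma contDiffOn_xDeriv (hΩ : IsOpen Ω) (hu : ContDiffOn ℝ ∞ u Ω) (k : ℕ) :
    ContDiffOn ℝ ∞ (xDeriv u k) Ω := by
  induction k with
  | zero => rwa [xDeriv_zero]
  | succ k ih =>
    refine (contDiffOn_fderiv_apply hΩ ih (0, 1)).congr fun z hz => ?_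
    rw [xDeriv_succ]
    exact (hasDerivAt_snd_of_differentiableAt (differentiableAt_of_contDiffOn hΩ ih hz)).deriv

lemma hasDerivAt_xDeriv_snd (hΩ : IsOpen Ω) (hu : ContDiffOn ℝ ∞ u Ω) (k : ℕ)
    (htx : (t, x) ∈ Ω) : HasDerivAt (fun y => xDeriv u k (t, y)) (xDeriv u (k + 1) (t, x)) x := by
  rw [xDeriv_succ]
  exact (hasDerivAt_snd_of_differentiableAt (differentiableAt_of_contDiffOn hΩ
    (contDiffOn_xDeriv hΩ hu k) htx)).differentiableAt.hasDerivAt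

lemma hasDerivAt_xDeriv_succ_fst (hΩ : IsOpen Ω) (hu : ContDiffOn ℝ ∞ u Ω) {k : ℕ}
    {G : ℝ × ℝ → ℝ} {G' : ℝ} (hG : ∀ z ∈ Ω, HasDerivAt (fun s => xDeriv u k (s, z.2)) (G z) z.1)
    (htx : (t, x) ∈ Ω) (hG' : HasDerivAt (fun y => G (t, y)) G' x) :
    HasDerivAt (fun s => xDeriv u (k + 1) (s, x)) G' t := by
  simpa only [xDeriv_succ] using
    hasDerivAt_deriv_swap hΩ (contDiffOn_xDeriv hΩ hu k) hG htx hG'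

lemma IsSolutionOn.hasDerivAt_xDeriv_one {g : ℝ → ℝ} {I : Set ℝ} (hs : IsSolutionOn g I Ω u)
    (htx : (t, x) ∈ Ω) : HasDerivAt (fun s => xDeriv u 1 (s, x)) (g (u (t, x))) t := by
  have hd := (hasDerivAt_fst_of_differentiableAt (differentiableAt_of_contDiffOn hs.isOpen
    (contDiffOn_xDeriv hs.isOpen hs.contDiffOn 1) htx)).differentiableAt.hasDerivAt
  have heq : (fun s => xDeriv u 1 (s, x)) = fun s => deriv (fun y => u (s, y)) x := by
    ext s
    rw [xDeriv_succ, xDeriv_zero]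
  rw [← hs.eqn t x htx]
  rwa [heq] at hd ⊢

end PartialDerivatives

section Evaluation

lemma hasDerivAt_eval {σ : Type*} (d : Derivation ℝ (MvPolynomial σ ℝ) (MvPolynomial σ ℝ))
    {γ : ℝ → σ → ℝ} {s : ℝ} (h : ∀ i, HasDerivAt (fun r => γ r i) (eval (γ s) (d (X i))) s)
    (p : MvPolynomial σ ℝ) : HasDerivAt (fun r => eval (γ r) p) (eval (γ s) (d p)) s := by
  induction p using MvPolynomial.induction_on with
  | C a => simpa using hasDerivAt_const s a
  | add p q hp hq => simpa using hp.fun_add hq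
  | mul_X p i hp =>
    simp only [Derivation.leibniz, map_add, map_mul, smul_eq_mul, eval_X]
    exact (hp.fun_mul (h i)).congr_deriv (by ring)

lemma eval_eq_of_mem_supported {R σ : Type*} [CommRing R] {s : Set σ} {p : MvPolynomial σ R}
    (hp : p ∈ supported R s) {v w : σ → R} (h : ∀ i ∈ s, v i = w i) : eval v p = eval w p :=
  eval₂Hom_congr' rfl (fun i hi _ => h i (mem_supported.mp hp hi)) rfl

/-- A differential polynomial, seen as a differential function. -/
def polyFun (p : DPoly ℝ) : DiffFun := fun _ w => eval (fun k => w (k + 1)) p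

lemma jetDeriv_succ_polyFun (k : ℕ) (p : DPoly ℝ) :
    jetDeriv (k + 1) (polyFun p) = polyFun (pderiv k p) := by
  classical
  ext x w
  have hX (j : ℕ) : HasDerivAt (fun s => Function.update w (k + 1) s (j + 1))
      (eval (fun i => Function.update w (k + 1) (w (k + 1)) (i + 1)) (pderiv k (X j)))
      (w (k + 1)) := by
    refine (hasDerivAt_pi.mp (hasDerivAt_update w (k + 1) (w (k + 1))) (j + 1)).congr_deriv ?_
    rw [pderiv_X, Pi.single_apply, Pi.single_apply]
    simp only [add_left_inj]
    split_ifs <;> simp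
  have h := (hasDerivAt_eval (pderiv k) hX p).deriv
  rwa [Function.update_eq_self] at h

/-- The variables of a differential polynomial, read off from a jet of order `q`. -/
def jetVars {q : ℕ} (z : ℝ × (Fin (q + 1) → ℝ)) (k : ℕ) : ℝ :=
  if h : k + 1 < q + 1 then z.2 ⟨k + 1, h⟩ else 0

lemma contDiff_eval_jetVars {q : ℕ} (p : DPoly ℝ) :
    ContDiff ℝ ∞ fun z : ℝ × (Fin (q + 1) → ℝ) => eval (jetVars z) p := by
  have hvar (k : ℕ) : ContDiff ℝ ∞ fun z : ℝ × (Fin (q + 1) → ℝ) => jetVars z k := by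
    unfold jetVars
    split_ifs <;> fun_prop
  induction p using MvPolynomial.induction_on with
  | C a => simpa using contDiff_const
  | add p r hp hr => simpa using hp.add hr
  | mul_X p k hp => simpa using hp.mul (hvar k)

lemma eval_jetVars {q : ℕ} {p : DPoly ℝ} (hp : p ∈ supported ℝ (Set.Iio q)) (x : ℝ) (w : ℕ → ℝ) :
    eval (jetVars (x, fun i : Fin (q + 1) => w i)) p = eval (fun k => w (k + 1)) p :=
  eval_eq_of_mem_supported hp fun _ hi => dif_pos (Nat.succ_lt_succ hi)

end Evaluation

section Sufficiency

variable {g : ℝ → ℝ} {I : Set ℝ} {Ω : Set (ℝ × ℝ)} {u : ℝ × ℝ → ℝ} {k t x : ℝ}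

/-- The value of the differential polynomial `p` on the function `u`. -/
def evalOn (u : ℝ × ℝ → ℝ) (p : DPoly ℝ) (z : ℝ × ℝ) : ℝ := eval (fun i => xDeriv u (i + 1) z) p

/-- The value of `F.1 * g(u) + F.2 * g'(u)` on the function `u`. -/
def fluxOn (g : ℝ → ℝ) (u : ℝ × ℝ → ℝ) (F : DPoly ℝ × DPoly ℝ) (z : ℝ × ℝ) : ℝ :=
  evalOn u F.1 z * g (u z) + evalOn u F.2 z * deriv g (u z)

lemma eval_jetVars_xJet {q : ℕ} {p : DPoly ℝ} (hp : p ∈ supported ℝ (Set.Iio q)) (u : ℝ × ℝ → ℝ)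
    (t x : ℝ) : eval (jetVars (xJet q u t x)) p = evalOn u p (t, x) :=
  eval_jetVars hp x fun i => xDeriv u i (t, x)

lemma hasDerivAt_evalOn_snd (hs : IsSolutionOn g I Ω u) (p : DPoly ℝ) (htx : (t, x) ∈ Ω) :
    HasDerivAt (fun y => evalOn u p (t, y)) (evalOn u (totD p) (t, x)) x :=
  hasDerivAt_eval totD (fun i => by
    rw [totD_X, eval_X]
    exact hasDerivAt_xDeriv_snd hs.isOpen hs.contDiffOn (i + 1) htx) p

lemma hasDerivAt_fluxOn_snd (hI : IsOpen I) (hg : ContDiffOn ℝ ∞ g I)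
    (hk : ∀ v ∈ I, deriv (deriv g) v = 4 * k * g v) (hs : IsSolutionOn g I Ω u)
    (F : DPoly ℝ × DPoly ℝ) (htx : (t, x) ∈ Ω) :
    HasDerivAt (fun y => fluxOn g u F (t, y)) (fluxOn g u (fluxD k F) (t, x)) x := by
  have huI : u (t, x) ∈ I := hs.mapsTo htx
  have hu : HasDerivAt (fun y => u (t, y)) (xDeriv u 1 (t, x)) x := by
    simpa only [xDeriv_zero] using hasDerivAt_xDeriv_snd hs.isOpen hs.contDiffOn 0 htx
  have hg₁ := (differentiableAt_of_contDiffOn hI hg huI).hasDerivAt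
  have hg₂ := (differentiableAt_of_contDiffOn hI
    ((contDiffOn_infty_iff_deriv_of_isOpen hI).mp hg).2 huI).hasDerivAt
  rw [hk _ huI] at hg₂
  refine (((hasDerivAt_evalOn_snd hs F.1 htx).mul (hg₁.comp x hu)).add
    ((hasDerivAt_evalOn_snd hs F.2 htx).mul (hg₂.comp x hu))).congr_deriv ?_
  simp only [fluxOn, fluxD, evalOn, map_add, map_mul, eval_C, eval_X, Function.comp_apply]
  ring

lemma hasDerivAt_xDeriv_succ_fst_of_isSolutionOn (hI : IsOpen I) (hg : ContDiffOn ℝ ∞ g I)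
    (hk : ∀ v ∈ I, deriv (deriv g) v = 4 * k * g v) (hs : IsSolutionOn g I Ω u) (i : ℕ) :
    ∀ z ∈ Ω,
      HasDerivAt (fun s => xDeriv u (i + 1) (s, z.2)) (fluxOn g u (evolCoeff k i) z) z.1 := by
  induction i with
  | zero =>
    intro z hz
    simpa [evolCoeff, fluxOn, evalOn] using hs.hasDerivAt_xDeriv_one hz
  | succ i ih =>
    intro z hz
    exact hasDerivAt_xDeriv_succ_fst hs.isOpen hs.contDiffOn ih hz
      (hasDerivAt_fluxOn_snd hI hg hk hs (evolCoeff k i) hz)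

lemma hasDerivAt_evalOn_fst (hI : IsOpen I) (hg : ContDiffOn ℝ ∞ g I)
    (hk : ∀ v ∈ I, deriv (deriv g) v = 4 * k * g v) (hs : IsSolutionOn g I Ω u) (p : DPoly ℝ)
    (htx : (t, x) ∈ Ω) :
    HasDerivAt (fun s => evalOn u p (s, x)) (fluxOn g u (evol k p) (t, x)) t := by
  set d := g (u (t, x)) • evolFst k + deriv g (u (t, x)) • evolSnd k with hd
  have heval (p : DPoly ℝ) : evalOn u (d p) (t, x) = fluxOn g u (evol k p) (t, x) := by
    simp only [hd, fluxOn, evalOn, evol_apply, Derivation.add_apply, Derivation.smul_apply, map_add,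
      smul_eval, mul_comm]
  rw [← heval]
  refine hasDerivAt_eval d (fun i => ?_) p
  have hi := hasDerivAt_xDeriv_succ_fst_of_isSolutionOn hI hg hk hs i _ htx
  rwa [← evol_X, ← heval] at hi

theorem exists_isConservationLaw (hI : IsOpen I) (hne : I.Nonempty) (hg : ContDiffOn ℝ ∞ g I)
    (hk : ∀ v ∈ I, deriv (deriv g) v = 4 * k * g v) {q : ℕ} (hq : 1 < q) :
    ∃ Pt Px : ℝ × (Fin (q + 1) → ℝ) → ℝ, IsConservationLaw g I q Set.univ Pt Px := by
  obtain ⟨r, rfl⟩ : ∃ r, q = r + 1 := ⟨q - 1, by omega⟩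
  obtain ⟨p, F, hp, hF₁, hF₂, hevol, htop⟩ := exists_conserved_density k (by omega : r ≠ 0)
  have hcoord : ContDiffOn ℝ ∞ (fun z : ℝ × (Fin (r + 1 + 1) → ℝ) => z.2 0)
    (jetDomain I Set.univ) := by fun_prop
  have hcomp {h : ℝ → ℝ} (hh : ContDiffOn ℝ ∞ h I) :
      ContDiffOn ℝ ∞ (fun z : ℝ × (Fin (r + 1 + 1) → ℝ) => h (z.2 0)) (jetDomain I Set.univ) :=
    hh.comp hcoord fun z hz => hz.1
  refine ⟨fun z => eval (jetVars z) p, fun z => -(eval (jetVars z) F.1 * g (z.2 0) +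
    eval (jetVars z) F.2 * deriv g (z.2 0)), ?_, ?_, ?_, ?_⟩
  · exact (contDiff_eval_jetVars p).contDiffOn
  · exact (((contDiff_eval_jetVars _).contDiffOn.mul (hcomp hg)).add
      ((contDiff_eval_jetVars _).contDiffOn.mul
        (hcomp ((contDiffOn_infty_iff_deriv_of_isOpen hI).mp hg).2))).neg
  · intro Ω u hs _ t x htx
    have hPt := hasDerivAt_evalOn_fst hI hg hk hs p htx
    have hPx := (hasDerivAt_fluxOn_snd hI hg hk hs F htx).fun_neg
    have hu (y : ℝ) : (xJet (r + 1) u t y).2 0 = u (t, y) := by simp [xJet]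
    simp only [eval_jetVars_xJet hp, eval_jetVars_xJet hF₁, eval_jetVars_xJet hF₂, hu]
    rw [hPt.deriv, hevol]
    exact (congrArg _ hPx.deriv).trans (add_neg_cancel _)
  · have htoDiffFun : toDiffFun (fun z : ℝ × (Fin (r + 1 + 1) → ℝ) => eval (jetVars z) p) =
        polyFun p := funext₂ fun x w => eval_jetVars hp x w
    obtain ⟨v, hv⟩ := hne
    refine ⟨r + 1 + r, by omega,
      (hasOrderOn_multiplier_iff _).mpr ⟨0, fun _ => v, ⟨hv, trivial⟩, ?_⟩⟩
    rw [htoDiffFun, jetDeriv_succ_polyFun, jetDeriv_succ_polyFun, htop]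
    simp [polyFun]

end Sufficiency

section SimilaritySolutions

lemma exists_contDiffOn_integralCurve {E : Type*} [NormedAddCommGroup E] [NormedSpace ℝ E]
    [CompleteSpace E] {f : E → E} {N : Set E} (hN : IsOpen N) (hf : ContDiffOn ℝ ∞ f N) {a : E}
    (ha : a ∈ N) (t₀ : ℝ) :
    ∃ ε > 0, ∃ α : ℝ → E, α t₀ = a ∧ Set.MapsTo α (Metric.ball t₀ ε) N ∧
      ContDiffOn ℝ ∞ α (Metric.ball t₀ ε) ∧
        ∀ t ∈ Metric.ball t₀ ε, HasDerivAt α (f (α t)) t := by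
  have hfa : ContDiffAt ℝ 1 f a := (hf.contDiffAt (hN.mem_nhds ha)).of_le
    (mod_cast (le_top : (1 : ℕ∞) ≤ ⊤))
  obtain ⟨α, hαt₀, δ, hδ, hα⟩ :=
    hfa.exists_forall_mem_closedBall_exists_eq_forall_mem_Ioo_hasDerivAt₀ t₀
  have hderiv : ∀ᶠ t in nhds t₀, HasDerivAt α (f (α t)) t :=
    Filter.eventually_of_mem (Ioo_mem_nhds (by linarith) (by linarith)) hα
  have hmem : ∀ᶠ t in nhds t₀, α t ∈ N :=
    hderiv.self_of_nhds.continuousAt.eventually (hαt₀ ▸ hN.mem_nhds ha)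
  obtain ⟨ε, hε, hball⟩ :=
    Metric.nhds_basis_closedBall.eventually_iff.mp (hmem.and hderiv)
  have hsub := Metric.ball_subset_closedBall (x := t₀) (ε := ε)
  refine ⟨ε, hε, α, hαt₀, fun t ht => (hball (hsub ht)).1, ?_, fun t ht => (hball (hsub ht)).2⟩
  rw [Real.closedBall_eq_Icc] at hball hsub
  exact (ODE.contDiffOn_enat_Icc_of_hasDerivWithinAt (f := fun _ => f)
    (hf.comp contDiffOn_snd fun _ h => h.2) (fun t ht => (hball ht).2.hasDerivWithinAt)
    fun t ht => (hball ht).1).mono hsub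

variable {g : ℝ → ℝ} {I J : Set ℝ} {W : ℝ → ℝ}

/-- A profile: a solution on `J` of the equation `z W'' + W' = g(W)` to which `u_tx = g(u)` reduces
for functions of the form `u = W(t (x + a))`. -/
structure IsProfile (g : ℝ → ℝ) (I J : Set ℝ) (W : ℝ → ℝ) : Prop where
  isOpen : IsOpen J
  contDiffOn : ContDiffOn ℝ ∞ W J
  mapsTo : Set.MapsTo W J I
  eqn : ∀ z ∈ J, z * deriv (deriv W) z + deriv W z = g (W z)

lemma exists_isProfile (hI : IsOpen I) (hg : ContDiffOn ℝ ∞ g I) {u₀ : ℝ} (hu₀ : u₀ ∈ I)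
    (y₀ : ℝ) {z₀ : ℝ} (hz₀ : z₀ ≠ 0) :
    ∃ J W, IsProfile g I J W ∧ z₀ ∈ J ∧ W z₀ = u₀ ∧ deriv W z₀ = y₀ := by
  let N : Set (ℝ × ℝ × ℝ) := {s | s.1 ≠ 0 ∧ s.2.1 ∈ I}
  let f : ℝ × ℝ × ℝ → ℝ × ℝ × ℝ := fun s => (1, s.2.2, (g s.2.1 - s.2.2) / s.1)
  have hN : IsOpen N := (isOpen_ne.preimage continuous_fst).inter
    (hI.preimage (continuous_fst.comp continuous_snd))
  have hf : ContDiffOn ℝ ∞ f N := by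
    have hgN : ContDiffOn ℝ ∞ (fun s : ℝ × ℝ × ℝ => g s.2.1) N :=
      hg.comp (t := I) (by fun_prop) fun s hs => hs.2
    exact contDiffOn_const.prodMk (ContDiffOn.prodMk (by fun_prop)
      ((hgN.sub (by fun_prop)).div (by fun_prop) fun s hs => hs.1))
  obtain ⟨ε, hε, α, hα₀, hαN, hαs, hα⟩ :=
    exists_contDiffOn_integralCurve hN hf (a := (z₀, u₀, y₀)) ⟨hz₀, hu₀⟩ z₀
  have hz₀ball : z₀ ∈ Metric.ball z₀ ε := Metric.mem_ball_self hε
  have hα₁ {z : ℝ} (hz : z ∈ Metric.ball z₀ ε) : HasDerivAt (fun s => (α s).1) 1 z :=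
    (hα z hz).fst
  have hα₂ {z : ℝ} (hz : z ∈ Metric.ball z₀ ε) : HasDerivAt (fun s => (α s).2.1) (α z).2.2 z :=
    (hα z hz).snd.fst
  have hα₃ {z : ℝ} (hz : z ∈ Metric.ball z₀ ε) :
      HasDerivAt (fun s => (α s).2.2) ((g (α z).2.1 - (α z).2.2) / (α z).1) z :=
    (hα z hz).snd.snd
  have hW' {z : ℝ} (hz : z ∈ Metric.ball z₀ ε) :
      deriv (deriv fun s => (α s).2.1) z = (g (α z).2.1 - (α z).2.2) / (α z).1 := by
    rw [(Filter.eventuallyEq_of_mem (Metric.isOpen_ball.mem_nhds hz)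
      fun s hs => (hα₂ hs).deriv).deriv_eq, (hα₃ hz).deriv]
  have hfst : Set.EqOn (fun s => (α s).1) id (Metric.ball z₀ ε) :=
    Metric.isOpen_ball.eqOn_of_deriv_eq (convex_ball z₀ ε).isPreconnected
      (fun s hs => (hα₁ hs).differentiableAt.differentiableWithinAt) differentiableOn_id
      (fun s hs => by rw [(hα₁ hs).deriv, deriv_id]) hz₀ball (by simp only [hα₀, id])
  refine ⟨Metric.ball z₀ ε, fun s => (α s).2.1, ⟨Metric.isOpen_ball, hαs.snd.fst,
    fun z hz => (hαN hz).2, fun z hz => ?_⟩, hz₀ball, by simp only [hα₀],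
      by rw [(hα₂ hz₀ball).deriv, hα₀]⟩
  have hz' : (α z).1 = z := hfst hz
  rw [hW' hz, (hα₂ hz).deriv, hz', mul_div_cancel₀ _ (hz' ▸ (hαN hz).1), sub_add_cancel]

lemma xDeriv_similarity (W : ℝ → ℝ) (a : ℝ) (k : ℕ) (t x : ℝ) :
    xDeriv (fun z => W (z.1 * (z.2 + a))) k (t, x) =
      t ^ k * iteratedDeriv k W (t * (x + a)) := by
  induction k generalizing x with
  | zero => simp [xDeriv_zero]
  | succ k ih =>
    rw [xDeriv_succ, funext ih, deriv_const_mul_field,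
      deriv_comp_add_const (fun y => iteratedDeriv k W (t * y)), deriv_comp_mul_left,
      iteratedDeriv_succ, smul_eq_mul, pow_succ, mul_assoc]

namespace IsProfile

variable (hW : IsProfile g I J W)
include hW

lemma contDiffOn_deriv : ContDiffOn ℝ ∞ (deriv W) J :=
  ((contDiffOn_infty_iff_deriv_of_isOpen hW.isOpen).mp hW.contDiffOn).2

lemma contDiffOn_deriv_deriv : ContDiffOn ℝ ∞ (deriv (deriv W)) J :=
  ((contDiffOn_infty_iff_deriv_of_isOpen hW.isOpen).mp hW.contDiffOn_deriv).2

lemma isSolutionOn (a : ℝ) :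
    IsSolutionOn g I {z | z.1 * (z.2 + a) ∈ J} fun z => W (z.1 * (z.2 + a)) := by
  refine ⟨hW.isOpen.preimage (by fun_prop), hW.contDiffOn.comp (by fun_prop) fun _ hz => hz,
    fun _ hz => hW.mapsTo hz, fun t x htx => ?_⟩
  have hux (s : ℝ) : deriv (fun y => W (s * (y + a))) x = s * deriv W (s * (x + a)) := by
    simpa [xDeriv_succ, xDeriv_zero] using xDeriv_similarity W a 1 s x
  have hs : HasDerivAt (fun s => s * (x + a)) (x + a) t := by
    simpa using (hasDerivAt_id' t).mul_const (x + a)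
  have hW' : HasDerivAt (fun s => deriv W (s * (x + a)))
      (deriv (deriv W) (t * (x + a)) * (x + a)) t :=
    HasDerivAt.comp (h₂ := deriv W) t
      (differentiableAt_of_contDiffOn hW.isOpen hW.contDiffOn_deriv htx).hasDerivAt hs
  simp only [hux]
  rw [((hasDerivAt_id' t).fun_mul hW').deriv, ← hW.eqn _ htx]
  ring

lemma eqn_deriv (hI : IsOpen I) (hg : ContDiffOn ℝ ∞ g I) {z : ℝ} (hz : z ∈ J) :
    z * deriv (deriv (deriv W)) z + 2 * deriv (deriv W) z = deriv g (W z) * deriv W z := by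
  have hderiv {h : ℝ → ℝ} (hh : ContDiffOn ℝ ∞ h J) : HasDerivAt h (deriv h z) z :=
    (differentiableAt_of_contDiffOn hW.isOpen hh hz).hasDerivAt
  have hgW := (differentiableAt_of_contDiffOn hI hg (hW.mapsTo hz)).hasDerivAt.comp z
    (hderiv hW.contDiffOn)
  have hlhs := ((hasDerivAt_id' z).fun_mul (hderiv hW.contDiffOn_deriv_deriv)).fun_add
    (hderiv hW.contDiffOn_deriv)
  have heq : (fun s => s * deriv (deriv W) s + deriv W s) =ᶠ[nhds z] g ∘ W :=
    Filter.eventuallyEq_of_mem (hW.isOpen.mem_nhds hz) hW.eqn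
  linear_combination -hgW.unique (hlhs.congr_of_eventuallyEq heq.symm)

end IsProfile

/-- The family of solutions, with parameter `ρ = u_t / u_x`, on which a conservation law is tested:
it goes through every jet `(x, u, u_x, u_xx)` with `u_x ≠ 0` for all but two values of `ρ`. -/
lemma exists_isSolutionOn_jet (hI : IsOpen I) (hg : ContDiffOn ℝ ∞ g I) {u₀ x₀ p r ρ : ℝ}
    (hu₀ : u₀ ∈ I) (hp : p ≠ 0) (hρ : ρ ≠ 0) (hκ : g u₀ - ρ * r ≠ 0) :
    ∃ (Ω : Set (ℝ × ℝ)) (u : ℝ × ℝ → ℝ) (t₀ : ℝ), IsSolutionOn g I Ω u ∧ (t₀, x₀) ∈ Ω ∧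
      u (t₀, x₀) = u₀ ∧ xDeriv u 1 (t₀, x₀) = p ∧ xDeriv u 2 (t₀, x₀) = r ∧
      ρ * p * xDeriv u 3 (t₀, x₀) = deriv g u₀ * p ^ 2 - 2 * r * (g u₀ - ρ * r) ∧
      HasDerivAt (fun s => u (s, x₀)) (ρ * p) t₀ := by
  set κ := g u₀ - ρ * r with hκ_def
  obtain ⟨β, hβ, hβκ⟩ : ∃ β, β ≠ 0 ∧ β * κ = p := ⟨p / κ, div_ne_zero hp hκ, div_mul_cancel₀ p hκ⟩
  obtain ⟨J, W, hW, hzJ, hWz, hW₁⟩ :=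
    exists_isProfile hI hg hu₀ κ (mul_ne_zero hβ (mul_ne_zero hρ hβ))
  set z := β * (ρ * β)
  have hzβ : β * (x₀ + (ρ * β - x₀)) = z := by rw [add_sub_cancel]
  have hW₂ := hW.eqn z hzJ
  have hW₃ := hW.eqn_deriv hI hg hzJ
  have hD := differentiableAt_of_contDiffOn hW.isOpen hW.contDiffOn hzJ
  rw [hWz, hW₁] at hW₂ hW₃
  have hr : β ^ 2 * deriv (deriv W) z = r :=
    mul_left_cancel₀ hρ (by linear_combination hW₂ + hκ_def)
  have hρβ : ρ * β ≠ 0 := mul_ne_zero hρ hβ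
  refine ⟨_, _, β, hW.isSolutionOn (ρ * β - x₀), ?_, ?_, ?_, ?_, ?_, ?_⟩
  · simpa only [Set.mem_ofPred_eq, hzβ]
  · simpa only [hzβ]
  · rw [xDeriv_similarity, hzβ, iteratedDeriv_one, hW₁, pow_one, hβκ]
  · rw [xDeriv_similarity, hzβ, iteratedDeriv_succ, iteratedDeriv_one, hr]
  · rw [xDeriv_similarity, hzβ, iteratedDeriv_succ, iteratedDeriv_succ, iteratedDeriv_one, ← hβκ]
    linear_combination β ^ 2 * κ * hW₃ - 2 * κ * hr
  · have hs : HasDerivAt (fun s => s * (x₀ + (ρ * β - x₀))) (ρ * β) β := by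
      simpa using (hasDerivAt_id' β).mul_const (ρ * β)
    rw [← hzβ] at hD
    refine (hD.hasDerivAt.comp β hs).congr_deriv ?_
    rw [hzβ, hW₁, ← hβκ]
    ring

end SimilaritySolutions

section DeterminingEquations

variable {q : ℕ}

/-- The direction of the coordinate `x` in the space of jets. -/
def dirX : ℝ × (Fin (q + 1) → ℝ) := (1, 0)

/-- The direction of the coordinate `∂ₓⁱ u` in the space of jets. -/
def dirU (i : Fin (q + 1)) : ℝ × (Fin (q + 1) → ℝ) := (0, Pi.single i 1)

lemma map_jet_eq_sum (L : ℝ × (Fin (q + 1) → ℝ) →L[ℝ] ℝ) (a : ℝ) (v : Fin (q + 1) → ℝ) :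
    L (a, v) = a * L dirX + ∑ i, v i * L (dirU i) := by
  have hsum : (a, v) = a • dirX + ∑ i, v i • dirU i := by
    ext i
    · simp [dirX, dirU, Prod.fst_sum]
    · simp [dirX, dirU, Prod.snd_sum, Pi.single_apply]
  simp only [hsum, map_add, map_sum, map_smul, smul_eq_mul]

variable {g : ℝ → ℝ} {I : Set ℝ} {V : Set (ℝ × (Fin q → ℝ))} {Ω : Set (ℝ × ℝ)} {u : ℝ × ℝ → ℝ}
  {t x : ℝ}

lemma isOpen_jetDomain (hI : IsOpen I) (hV : IsOpen V) : IsOpen (jetDomain I V) :=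
  (hI.preimage (by fun_prop : Continuous fun z : ℝ × (Fin (q + 1) → ℝ) => z.2 0)).inter
    (hV.preimage (by fun_prop :
      Continuous fun z : ℝ × (Fin (q + 1) → ℝ) => (z.1, fun i : Fin q => z.2 i.succ)))

lemma hasDerivAt_xJet_fst {v : Fin (q + 1) → ℝ}
    (hv : ∀ i : Fin (q + 1), HasDerivAt (fun s => xDeriv u i (s, x)) (v i) t) :
    HasDerivAt (fun s => xJet q u s x) (0, v) t :=
  (hasDerivAt_const t x).prodMk (hasDerivAt_pi.mpr hv)

lemma hasDerivAt_xJet_snd (hΩ : IsOpen Ω) (hu : ContDiffOn ℝ ∞ u Ω) (htx : (t, x) ∈ Ω) :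
    HasDerivAt (fun y => xJet q u t y) (1, fun i => xDeriv u (i + 1) (t, x)) x :=
  (hasDerivAt_id' x).prodMk (hasDerivAt_pi.mpr fun i => hasDerivAt_xDeriv_snd hΩ hu i htx)

lemma continuousOn_xJet (hΩ : IsOpen Ω) (hu : ContDiffOn ℝ ∞ u Ω) :
    ContinuousOn (fun z : ℝ × ℝ => xJet q u z.1 z.2) Ω :=
  continuousOn_snd.prodMk (continuousOn_pi.mpr fun i => (contDiffOn_xDeriv hΩ hu i).continuousOn)

lemma IsConservationLaw.fderiv_add_fderiv_eq_zero {Pt Px : ℝ × (Fin (q + 1) → ℝ) → ℝ}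
    (hlaw : IsConservationLaw g I q V Pt Px) (hI : IsOpen I) (hV : IsOpen V)
    (hs : IsSolutionOn g I Ω u) (htx : (t, x) ∈ Ω) (hjet : xJet q u t x ∈ jetDomain I V)
    {v : Fin (q + 1) → ℝ}
    (hv : ∀ i : Fin (q + 1), HasDerivAt (fun s => xDeriv u i (s, x)) (v i) t) :
    fderiv ℝ Pt (xJet q u t x) (0, v) +
      fderiv ℝ Px (xJet q u t x) (1, fun i => xDeriv u (i + 1) (t, x)) = 0 := by
  have hJ := isOpen_jetDomain hI hV
  let Ω' := Ω ∩ (fun z : ℝ × ℝ => xJet q u z.1 z.2) ⁻¹' jetDomain I V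
  have hs' : IsSolutionOn g I Ω' u :=
    ⟨(continuousOn_xJet hs.isOpen hs.contDiffOn).isOpen_inter_preimage hs.isOpen hJ,
      hs.contDiffOn.mono Set.inter_subset_left, fun z hz => hs.mapsTo hz.1,
      fun t x h => hs.eqn t x h.1⟩
  have hPt := (differentiableAt_of_contDiffOn hJ hlaw.contDiffOn_Pt hjet).hasFDerivAt
  have hPx := (differentiableAt_of_contDiffOn hJ hlaw.contDiffOn_Px hjet).hasFDerivAt
  have hcons := hlaw.conserved Ω' u hs' (fun t x h => h.2) t x ⟨htx, hjet⟩
  rwa [← (hPt.comp_hasDerivAt t (hasDerivAt_xJet_fst hv)).deriv,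
    ← (hPx.comp_hasDerivAt x (hasDerivAt_xJet_snd hs.isOpen hs.contDiffOn htx)).deriv]

lemma eq_zero_of_eventually_quadratic_eq_zero {a b c : ℝ}
    (h : ∀ᶠ ρ in Filter.atTop, a * ρ ^ 2 + b * ρ + c = 0) : a = 0 ∧ b = 0 ∧ c = 0 := by
  obtain ⟨R, hR⟩ := Filter.eventually_atTop.mp h
  have h₀ := hR R le_rfl
  have h₁ := hR (R + 1) (by linarith)
  have h₂ := hR (R + 2) (by linarith)
  obtain rfl : a = 0 := by linear_combination (h₀ - 2 * h₁ + h₂) / 2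
  obtain rfl : b = 0 := by linear_combination h₁ - h₀
  exact ⟨rfl, rfl, by linear_combination h₀⟩

lemma IsConservationLaw.eq_zero_of_ne {V : Set (ℝ × (Fin 2 → ℝ))} {Pt Px : ℝ × (Fin 3 → ℝ) → ℝ}
    (hlaw : IsConservationLaw g I 2 V Pt Px) (hI : IsOpen I) (hV : IsOpen V)
    (hg : ContDiffOn ℝ ∞ g I) {z : ℝ × (Fin 3 → ℝ)} (hz : z ∈ jetDomain I V) (hp : z.2 1 ≠ 0)
    {ρ : ℝ} (hρ : ρ ≠ 0) (hκ : g (z.2 0) - ρ * z.2 2 ≠ 0) :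
    fderiv ℝ Pt z (dirU 0) * z.2 1 ^ 2 * ρ ^ 2 +
      (((fderiv ℝ Pt z (dirU 1) * g (z.2 0) +
        fderiv ℝ Pt z (dirU 2) * (z.2 1 * deriv g (z.2 0)) + fderiv ℝ Px z dirX +
        z.2 1 * fderiv ℝ Px z (dirU 0) + z.2 2 * fderiv ℝ Px z (dirU 1)) * z.2 1 +
        2 * z.2 2 ^ 2 * fderiv ℝ Px z (dirU 2)) * ρ) +
      fderiv ℝ Px z (dirU 2) * (deriv g (z.2 0) * z.2 1 ^ 2 - 2 * z.2 2 * g (z.2 0)) = 0 := by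
  obtain ⟨Ω, u, t, hs, htx, hu₀, hu₁, hu₂, hu₃, hut⟩ :=
    exists_isSolutionOn_jet hI hg (x₀ := z.1) hz.1 hp hρ hκ
  have hjet : xJet 2 u t z.1 = z := by
    refine Prod.ext rfl (funext fun i => ?_)
    fin_cases i
    exacts [hu₀, hu₁, hu₂]
  have hux := hasDerivAt_xDeriv_snd hs.isOpen hs.contDiffOn 0 htx
  have hgu := (differentiableAt_of_contDiffOn hI hg (hs.mapsTo htx)).hasDerivAt
  rw [xDeriv_zero] at hux
  have hv (i : Fin 3) : HasDerivAt (fun s => xDeriv u i (s, z.1))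
      (![ρ * z.2 1, g (z.2 0), deriv g (z.2 0) * z.2 1] i) t := by
    fin_cases i
    · simpa [xDeriv_zero] using hut
    · simpa [hu₀] using hs.hasDerivAt_xDeriv_one htx
    · simpa [hu₀, hu₁] using hasDerivAt_xDeriv_succ_fst hs.isOpen hs.contDiffOn
        (fun z hz => hs.hasDerivAt_xDeriv_one hz) htx (hgu.comp z.1 hux)
  have h := hlaw.fderiv_add_fderiv_eq_zero hI hV hs htx (by rwa [hjet]) hv
  rw [hjet, map_jet_eq_sum _ 0, map_jet_eq_sum _ 1] at h
  simp only [Fin.sum_univ_three, Matrix.cons_val, Fin.coe_ofNat_eq_mod, Nat.reduceMod,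
    Nat.reduceAdd, hu₁, hu₂] at h
  linear_combination ρ * z.2 1 * h - fderiv ℝ Px z (dirU 2) * hu₃

/-- The jets of second order in `jetDomain I V` with `u_x ≠ 0` and `u_xx ≠ 0`. -/
def nondegenerateJets (I : Set ℝ) (V : Set (ℝ × (Fin 2 → ℝ))) : Set (ℝ × (Fin 3 → ℝ)) :=
  {z | z ∈ jetDomain I V ∧ z.2 1 ≠ 0 ∧ z.2 2 ≠ 0}

section

variable {V : Set (ℝ × (Fin 2 → ℝ))} {Pt Px : ℝ × (Fin 3 → ℝ) → ℝ}

lemma isOpen_nondegenerateJets (hI : IsOpen I) (hV : IsOpen V) :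
    IsOpen (nondegenerateJets I V) :=
  (isOpen_jetDomain hI hV).inter
    ((isOpen_ne_fun (by fun_prop) (by fun_prop)).inter (isOpen_ne_fun (by fun_prop) (by fun_prop)))

lemma IsConservationLaw.determining_equations (hlaw : IsConservationLaw g I 2 V Pt Px)
    (hI : IsOpen I) (hV : IsOpen V) (hg : ContDiffOn ℝ ∞ g I) {z : ℝ × (Fin 3 → ℝ)}
    (hz : z ∈ nondegenerateJets I V) :
    fderiv ℝ Pt z (dirU 0) = 0 ∧
      (fderiv ℝ Pt z (dirU 1) * g (z.2 0) +
        fderiv ℝ Pt z (dirU 2) * (z.2 1 * deriv g (z.2 0)) + fderiv ℝ Px z dirX +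
        z.2 1 * fderiv ℝ Px z (dirU 0) + z.2 2 * fderiv ℝ Px z (dirU 1)) * z.2 1 +
        2 * z.2 2 ^ 2 * fderiv ℝ Px z (dirU 2) = 0 ∧
      fderiv ℝ Px z (dirU 2) * (deriv g (z.2 0) * z.2 1 ^ 2 - 2 * z.2 2 * g (z.2 0)) = 0 := by
  obtain ⟨hzJ, hp, hr⟩ := hz
  obtain ⟨h₂, h₁, h₀⟩ := eq_zero_of_eventually_quadratic_eq_zero <| by
    filter_upwards [Filter.eventually_ne_atTop 0,
      Filter.eventually_ne_atTop (g (z.2 0) / z.2 2)] with ρ hρ hρ'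
    exact hlaw.eq_zero_of_ne hI hV hg hzJ hp hρ
      fun h => hρ' (eq_div_of_mul_eq hr (sub_eq_zero.mp h).symm)
  exact ⟨(mul_eq_zero.mp h₂).resolve_right (pow_ne_zero 2 hp), h₁, h₀⟩

end

end DeterminingEquations

open TopologicalSpace

section SmoothFunctions

variable {E : Type*}

section

variable [TopologicalSpace E] {D : Opens E}

/-- The extension by zero of a function on an open set, whose derivatives are those of `f`. -/
def zeroExt (f : D → ℝ) : E → ℝ := Function.extend Subtype.val f 0

lemma zeroExt_coe (f : D → ℝ) (z : D) : zeroExt f z = f z :=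
  Subtype.val_injective.extend_apply _ _ _

lemma eqOn_zeroExt {f : D → ℝ} {F : E → ℝ} (h : ∀ z : D, f z = F z) : Set.EqOn (zeroExt f) F D :=
  fun z hz => (zeroExt_coe f ⟨z, hz⟩).trans (h ⟨z, hz⟩)

end

variable [NormedAddCommGroup E] [NormedSpace ℝ E] {D : Opens E}

lemma fderiv_zeroExt {f : D → ℝ} {F : E → ℝ} (h : ∀ z : D, f z = F z) (z : D) :
    fderiv ℝ (zeroExt f) z = fderiv ℝ F z :=
  (Filter.eventuallyEq_of_mem (D.isOpen.mem_nhds z.2) (eqOn_zeroExt h)).fderiv_eq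

variable (D) in
/-- The algebra of smooth functions on the open set `D`. -/
def smoothAlg : Subalgebra ℝ (D → ℝ) where
  carrier := {f | ContDiffOn ℝ ∞ (zeroExt f) D}
  mul_mem' {f h} hf hh := (hf.mul hh).congr <| eqOn_zeroExt fun z => by
    rw [Pi.mul_apply, zeroExt_coe, zeroExt_coe]
  add_mem' {f h} hf hh := (hf.add hh).congr <| eqOn_zeroExt fun z => by
    rw [Pi.add_apply, zeroExt_coe, zeroExt_coe]
  algebraMap_mem' r := (contDiffOn_const (c := r)).congr (eqOn_zeroExt fun _ => rfl)

namespace smoothAlg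

/-- The restriction to `D` of a function that is smooth there, as an element of `smoothAlg D`. -/
def of (F : E → ℝ) (hF : ContDiffOn ℝ ∞ F D) : smoothAlg D :=
  ⟨fun z => F z, hF.congr (eqOn_zeroExt fun _ => rfl)⟩

lemma differentiableAt (f : smoothAlg D) (z : D) : DifferentiableAt ℝ (zeroExt f.1) z :=
  differentiableAt_of_contDiffOn D.isOpen f.2 z.2

end smoothAlg

/-- The derivative in the direction `v`, as a derivation of the algebra of smooth functions. -/
def dirDeriv (v : E) : Derivation ℝ (smoothAlg D) (smoothAlg D) :=
  Derivation.mk'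
    { toFun := fun f => smoothAlg.of (fun z => fderiv ℝ (zeroExt f.1) z v)
        (contDiffOn_fderiv_apply D.isOpen f.2 v)
      map_add' := fun f h => Subtype.ext <| funext fun z => by
        change fderiv ℝ (zeroExt (f.1 + h.1)) z v =
          fderiv ℝ (zeroExt f.1) z v + fderiv ℝ (zeroExt h.1) z v
        rw [fderiv_zeroExt (F := zeroExt f.1 + zeroExt h.1) fun z => by
          rw [Pi.add_apply, Pi.add_apply, zeroExt_coe, zeroExt_coe],
          fderiv_add (smoothAlg.differentiableAt f z) (smoothAlg.differentiableAt h z)]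
        rfl
      map_smul' := fun c f => Subtype.ext <| funext fun z => by
        change fderiv ℝ (zeroExt (c • f.1)) z v = c * fderiv ℝ (zeroExt f.1) z v
        rw [fderiv_zeroExt (F := c • zeroExt f.1) fun z => by
          rw [Pi.smul_apply, Pi.smul_apply, zeroExt_coe],
          fderiv_const_smul (smoothAlg.differentiableAt f z)]
        rfl }
    fun f h => Subtype.ext <| funext fun z => by
      change fderiv ℝ (zeroExt (f.1 * h.1)) z v =
        f.1 z * fderiv ℝ (zeroExt h.1) z v + h.1 z * fderiv ℝ (zeroExt f.1) z v
      rw [fderiv_zeroExt (F := zeroExt f.1 * zeroExt h.1) fun z => by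
        rw [Pi.mul_apply, Pi.mul_apply, zeroExt_coe, zeroExt_coe],
        fderiv_mul (smoothAlg.differentiableAt f z) (smoothAlg.differentiableAt h z), zeroExt_coe,
        zeroExt_coe]
      rfl

lemma dirDeriv_of (v : E) {F : E → ℝ} (hF : ContDiffOn ℝ ∞ F D) :
    dirDeriv v (smoothAlg.of F hF) =
      smoothAlg.of (fun z => fderiv ℝ F z v) (contDiffOn_fderiv_apply D.isOpen hF v) :=
  Subtype.ext <| funext fun z => congrArg (· v) (fderiv_zeroExt (fun _ => rfl) z)

lemma dirDeriv_comm (v w : E) (f : smoothAlg D) :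
    dirDeriv v (dirDeriv w f) = dirDeriv w (dirDeriv v f) := by
  refine Subtype.ext <| funext fun z => ?_
  have hfderiv (v : E) : fderiv ℝ (zeroExt (dirDeriv v f).1) z =
      fderiv ℝ (fun y => fderiv ℝ (zeroExt f.1) y v) z :=
    fderiv_zeroExt (f := (dirDeriv v f).1) (fun _ => rfl) z
  change fderiv ℝ (zeroExt (dirDeriv w f).1) z v = fderiv ℝ (zeroExt (dirDeriv v f).1) z w
  rw [hfderiv, hfderiv]
  exact fderiv_fderiv_apply_comm D.isOpen f.2 z.2 w v

variable (D) in
/-- The smooth functions on `D` that are constant along the lines in the direction `e`, also where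
such a line leaves `D` and enters it again. -/
def lineInvariants (e : E) : Subalgebra ℝ (smoothAlg D) where
  carrier := {f | ∀ (z w : D) (s : ℝ), (w : E) = z + s • e → f.1 w = f.1 z}
  mul_mem' {_ _} hf hh := fun z w s hw => congrArg₂ (· * ·) (hf z w s hw) (hh z w s hw)
  add_mem' {_ _} hf hh := fun z w s hw => congrArg₂ (· + ·) (hf z w s hw) (hh z w s hw)
  algebraMap_mem' _ := fun _ _ _ _ => rfl

lemma dirDeriv_mem_lineInvariants {e : E} {f : smoothAlg D} (hf : f ∈ lineInvariants D e) (v : E) :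
    dirDeriv v f ∈ lineInvariants D e := by
  intro z w s hw
  have hshift : (fun y => zeroExt f.1 (y + s • e)) =ᶠ[nhds ↑z] zeroExt f.1 := by
    have hcont : ContinuousAt (fun y : E => y + s • e) z := by fun_prop
    filter_upwards [hcont.eventually_mem (hw ▸ D.isOpen.mem_nhds w.2), D.isOpen.mem_nhds z.2]
      with y hy hy'
    exact (zeroExt_coe f.1 ⟨_, hy⟩).trans
      ((hf ⟨y, hy'⟩ ⟨_, hy⟩ s rfl).trans (zeroExt_coe f.1 ⟨y, hy'⟩).symm)
  change fderiv ℝ (zeroExt f.1) w v = fderiv ℝ (zeroExt f.1) z v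
  rw [hw, ← fderiv_comp_add_right, hshift.fderiv_eq]

lemma of_mem_lineInvariants {e : E} {F : E → ℝ} (hF : ContDiffOn ℝ ∞ F D)
    (hD : ∀ z ∈ D, ∀ s : ℝ, z + s • e ∈ D → segment ℝ z (z + s • e) ⊆ D)
    (he : ∀ z ∈ D, fderiv ℝ F z e = 0) : smoothAlg.of F hF ∈ lineInvariants D e := by
  rintro z w s hw
  have hseg := hD z z.2 s (hw ▸ w.2)
  obtain ⟨y, hy, hyF⟩ := domain_mvt (fun y hy =>
    (differentiableAt_of_contDiffOn D.isOpen hF (hseg hy)).hasFDerivAt.hasFDerivWithinAt)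
    (convex_segment _ _) (left_mem_segment ℝ _ _) (right_mem_segment ℝ _ _)
  rw [add_sub_cancel_left, map_smul, he y (hseg hy), smul_zero, ← hw] at hyF
  exact sub_eq_zero.mp hyF

end SmoothFunctions

section Nondegeneracy

variable {q : ℕ}

lemma jetDeriv_eq_fderiv {D : Set (ℝ × (Fin (q + 1) → ℝ))} {P : ℝ × (Fin (q + 1) → ℝ) → ℝ}
    {F : DiffFun} (hD : IsOpen D) (hP : ContDiffOn ℝ ∞ P D)
    (hF : ∀ x w, (x, fun i : Fin (q + 1) => w i) ∈ D → F x w = P (x, fun i => w i))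
    {x : ℝ} {w : ℕ → ℝ} (hw : (x, fun i : Fin (q + 1) => w i) ∈ D) (i : Fin (q + 1)) :
    jetDeriv i F x w = fderiv ℝ P (x, fun i => w i) (dirU i) := by
  have hupdate (s : ℝ) : (fun j : Fin (q + 1) => Function.update w i s j) =
      Function.update (fun j : Fin (q + 1) => w j) i s :=
    Function.update_comp_eq_of_injective w Fin.val_injective i s
  let γ (s : ℝ) : ℝ × (Fin (q + 1) → ℝ) := (x, Function.update (fun j => w j) i s)
  have hγ₀ : γ (w i) = (x, fun j : Fin (q + 1) => w j) :=
    Prod.ext rfl (Function.update_eq_self i _)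
  have hγ : HasDerivAt γ (dirU i) (w i) := (hasDerivAt_const _ x).prodMk (hasDerivAt_update _ _ _)
  have hFγ : (fun s => F x (Function.update w i s)) =ᶠ[nhds (w i)] P ∘ γ := by
    filter_upwards [hγ.continuousAt.eventually_mem (hD.mem_nhds (hγ₀ ▸ hw))] with s hs
    have hs' := hF x (Function.update w i s)
    rw [hupdate] at hs'
    exact hs' hs
  have hPd := (differentiableAt_of_contDiffOn hD hP (hγ₀ ▸ hw : γ (w i) ∈ D)).hasFDerivAt
  rw [jetDeriv, hFγ.deriv_eq, (hPd.comp_hasDerivAt _ hγ).deriv, hγ₀]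

lemma dense_setOf_snd_apply_ne_zero (i : Fin (q + 1)) :
    Dense {z : ℝ × (Fin (q + 1) → ℝ) | z.2 i ≠ 0} :=
  (dense_compl_singleton (0 : ℝ)).preimage ((isOpenMap_eval i).comp isOpenMap_snd)

variable {g : ℝ → ℝ} {I : Set ℝ} {V : Set (ℝ × (Fin 2 → ℝ))} {Pt Px : ℝ × (Fin 3 → ℝ) → ℝ}

lemma IsConservationLaw.exists_mem_nondegenerateJets (hlaw : IsConservationLaw g I 2 V Pt Px)
    (hI : IsOpen I) (hV : IsOpen V) :
    ∃ z ∈ nondegenerateJets I V,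
      fderiv ℝ (fun z => fderiv ℝ Pt z (dirU 2)) z (dirU 2) ≠ 0 := by
  have hJ := isOpen_jetDomain hI hV
  have hPr := contDiffOn_fderiv_apply hJ hlaw.contDiffOn_Pt (dirU 2)
  have hPrr := contDiffOn_fderiv_apply hJ hPr (dirU 2)
  obtain ⟨n, hn, hord⟩ := hlaw.order
  obtain rfl : n = 1 + 1 + 1 := by omega
  obtain ⟨x, w, hw, hne⟩ := (hasOrderOn_multiplier_iff Pt).mp hord
  have hne' : fderiv ℝ (fun z => fderiv ℝ Pt z (dirU 2)) (x, fun i => w i) (dirU 2) ≠ 0 :=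
    fun h => hne <| (jetDeriv_eq_fderiv hJ hPr (fun x w hw =>
      jetDeriv_eq_fderiv hJ hlaw.contDiffOn_Pt (fun _ _ _ => rfl) hw 2) hw 2).trans h
  have hdense : Dense ({z | z.2 1 ≠ 0} ∩ {z | z.2 2 ≠ 0} : Set (ℝ × (Fin 3 → ℝ))) :=
    (dense_setOf_snd_apply_ne_zero 1).inter_of_isOpen_left (dense_setOf_snd_apply_ne_zero 2)
      (isOpen_ne_fun (by fun_prop) (by fun_prop))
  obtain ⟨z, ⟨hzJ, hz⟩, hzpr⟩ := hdense.inter_open_nonempty _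
    (hPrr.continuousOn.isOpen_inter_preimage hJ isOpen_compl_singleton) ⟨_, hw, hne'⟩
  exact ⟨z, ⟨hzJ, hzpr⟩, hz⟩

end Nondegeneracy

section JetAlgebra

variable {q : ℕ} {D : Opens (ℝ × (Fin (q + 1) → ℝ))}

/-- The coordinate `∂ₓⁱ u` of a jet, as a smooth function. -/
def jetCoord (i : Fin (q + 1)) : smoothAlg D := smoothAlg.of (fun z => z.2 i) (by fun_prop)

lemma dirDeriv_jetCoord (v : ℝ × (Fin (q + 1) → ℝ)) (i : Fin (q + 1)) :
    dirDeriv v (jetCoord i : smoothAlg D) = algebraMap ℝ _ (v.2 i) := by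
  let L : ℝ × (Fin (q + 1) → ℝ) →L[ℝ] ℝ :=
    (ContinuousLinearMap.proj i).comp (ContinuousLinearMap.snd ℝ ℝ (Fin (q + 1) → ℝ))
  rw [jetCoord, dirDeriv_of]
  exact Subtype.ext <| funext fun z => congrArg (· v) (L.hasFDerivAt (x := z.1)).fderiv

lemma jetCoord_mem_lineInvariants {e : ℝ × (Fin (q + 1) → ℝ)} {i : Fin (q + 1)} (he : e.2 i = 0) :
    jetCoord i ∈ lineInvariants D e := fun z w s hw => by
  change (w : ℝ × (Fin (q + 1) → ℝ)).2 i = (z : ℝ × (Fin (q + 1) → ℝ)).2 i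
  simp [hw, he]

end JetAlgebra

section DifferentialConsequences

variable {D : Opens (ℝ × (Fin 3 → ℝ))}

local notation "∂ₓ" => dirDeriv dirX
local notation "∂ᵤ" => dirDeriv (dirU 0)
local notation "∂ₚ" => dirDeriv (dirU 1)
local notation "∂ᵣ" => dirDeriv (dirU 2)
local notation "𝐩" => jetCoord 1
local notation "𝐫" => jetCoord 2

variable {F P Q : smoothAlg D} {G : ℕ → smoothAlg D}

lemma dirDeriv_dirX_jetCoord (i : Fin 3) : ∂ₓ (jetCoord i : smoothAlg D) = 0 := by
  simp [dirDeriv_jetCoord, dirX]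

lemma dirDeriv_dirU_jetCoord_self (i : Fin 3) :
    dirDeriv (dirU i) (jetCoord i : smoothAlg D) = 1 := by
  simp [dirDeriv_jetCoord, dirU]

lemma dirDeriv_dirU_jetCoord_of_ne {i j : Fin 3} (h : j ≠ i) :
    dirDeriv (dirU i) (jetCoord j : smoothAlg D) = 0 := by
  simp [dirDeriv_jetCoord, dirU, h]

lemma dirDeriv_ofNat (v : ℝ × (Fin 3 → ℝ)) (n : ℕ) [n.AtLeastTwo] :
    dirDeriv v (ofNat(n) : smoothAlg D) = 0 :=
  (dirDeriv v).map_natCast n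

lemma two_mul_mul_sq_eq_zero (hG : ∀ v n, dirDeriv v (G n) = v.2 0 • G (n + 1))
    (hF : F * (G 1 * 𝐩 ^ 2 - 2 * 𝐫 * G 0) = 0) : 2 * G 0 * F ^ 2 = 0 := by
  have hh : ∂ᵣ (G 1 * 𝐩 ^ 2 - 2 * 𝐫 * G 0) = -(2 * G 0) := by
    simp [hG, dirDeriv_jetCoord, dirDeriv_ofNat, dirU, mul_comm]
  have hF' := congrArg ∂ᵣ hF
  simp only [Derivation.leibniz, hh, map_zero, smul_eq_mul] at hF'
  linear_combination ∂ᵣ F * hF - F * hF'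

variable (hG : ∀ v n, dirDeriv v (G n) = v.2 0 • G (n + 1)) (hQ : ∂ᵣ Q = 0)
  (hE : ∂ₚ P * G 0 + ∂ᵣ P * 𝐩 * G 1 + ∂ₓ Q + 𝐩 * ∂ᵤ Q + 𝐫 * ∂ₚ Q = 0)

include hG hQ hE

lemma determining_dirU_two :
    ∂ₚ (∂ᵣ P) * G 0 + ∂ᵣ (∂ᵣ P) * 𝐩 * G 1 + ∂ₚ Q = 0 := by
  have hGr (n : ℕ) : ∂ᵣ (G n) = 0 := by simp [hG, dirU]
  have hEr := congrArg ∂ᵣ hE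
  simp only [map_add, map_zero, Derivation.leibniz, smul_eq_mul, dirDeriv_comm (dirU 2) (dirU 0),
    dirDeriv_comm (dirU 2) (dirU 1), dirDeriv_comm (dirU 2) dirX, hQ, hGr,
    dirDeriv_dirU_jetCoord_self, dirDeriv_dirU_jetCoord_of_ne (by decide : (1 : Fin 3) ≠ 2)] at hEr
  linear_combination hEr

lemma determining_dirU_two_two :
    ∂ₚ (∂ᵣ (∂ᵣ P)) * G 0 + ∂ᵣ (∂ᵣ (∂ᵣ P)) * 𝐩 * G 1 = 0 := by
  have hGr (n : ℕ) : ∂ᵣ (G n) = 0 := by simp [hG, dirU]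
  have hErr := congrArg ∂ᵣ (determining_dirU_two hG hQ hE)
  simp only [map_add, map_zero, Derivation.leibniz, smul_eq_mul, dirDeriv_comm (dirU 2) (dirU 1),
    hQ, hGr, dirDeriv_dirU_jetCoord_of_ne (by decide : (1 : Fin 3) ≠ 2)] at hErr
  linear_combination hErr

lemma dirDeriv_dirU_zero_flux (hP : ∂ᵤ P = 0) (hPprr : ∂ₚ (∂ᵣ (∂ᵣ P)) = 0) :
    ∂ᵤ Q = (∂ₓ (∂ₚ (∂ᵣ P)) - ∂ₚ (∂ₚ P) + 𝐫 * ∂ₚ (∂ₚ (∂ᵣ P))) * G 0 +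
      (𝐩 * ∂ₓ (∂ᵣ (∂ᵣ P)) - ∂ᵣ P + 𝐫 * ∂ᵣ (∂ᵣ P)) * G 1 + 𝐩 ^ 2 * ∂ᵣ (∂ᵣ P) * G 2 := by
  have hGx (n : ℕ) : ∂ₓ (G n) = 0 := by simp [hG, dirX]
  have hGu (n : ℕ) : ∂ᵤ (G n) = G (n + 1) := by simp [hG, dirU]
  have hGp (n : ℕ) : ∂ₚ (G n) = 0 := by simp [hG, dirU]
  have hPru : ∂ᵤ (∂ᵣ P) = 0 := by rw [dirDeriv_comm, hP, map_zero]
  have hPpru : ∂ᵤ (∂ₚ (∂ᵣ P)) = 0 := by rw [dirDeriv_comm, hPru, map_zero]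
  have hPrru : ∂ᵤ (∂ᵣ (∂ᵣ P)) = 0 := by rw [dirDeriv_comm, hPru, map_zero]
  have hEp := congrArg ∂ₚ hE
  have hEr := determining_dirU_two hG hQ hE
  have hErx := congrArg ∂ₓ hEr
  have hEru := congrArg ∂ᵤ hEr
  have hErp := congrArg ∂ₚ hEr
  simp only [map_add, map_zero, Derivation.leibniz, smul_eq_mul, dirDeriv_comm (dirU 1) dirX,
    dirDeriv_comm (dirU 1) (dirU 0), hGx, hGu, hGp, hPprr, hPpru, hPrru, dirDeriv_dirX_jetCoord,
    dirDeriv_dirU_jetCoord_self, dirDeriv_dirU_jetCoord_of_ne (by decide : (2 : Fin 3) ≠ 1),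
    dirDeriv_dirU_jetCoord_of_ne (by decide : (1 : Fin 3) ≠ 0)] at hEp hErx hEru hErp
  linear_combination hEp - hErx - 𝐩 * hEru - 𝐫 * hErp

lemma determining_quadratic (hP : ∂ᵤ P = 0) (hPprr : ∂ₚ (∂ᵣ (∂ᵣ P)) = 0) :
    (∂ₚ (∂ₚ (∂ₚ P)) - ∂ₓ (∂ₚ (∂ₚ (∂ᵣ P))) - 𝐫 * ∂ₚ (∂ₚ (∂ₚ (∂ᵣ P)))) * G 0 =
      ∂ₓ (∂ᵣ (∂ᵣ P)) * G 1 + 3 * 𝐩 * ∂ᵣ (∂ᵣ P) * G 2 := by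
  have hGu (n : ℕ) : ∂ᵤ (G n) = G (n + 1) := by simp [hG, dirU]
  have hGp (n : ℕ) : ∂ₚ (G n) = 0 := by simp [hG, dirU]
  have hPru : ∂ᵤ (∂ᵣ P) = 0 := by rw [dirDeriv_comm, hP, map_zero]
  have hPpru : ∂ᵤ (∂ₚ (∂ᵣ P)) = 0 := by rw [dirDeriv_comm, hPru, map_zero]
  have hPrru : ∂ᵤ (∂ᵣ (∂ᵣ P)) = 0 := by rw [dirDeriv_comm, hPru, map_zero]
  have hQup := congrArg ∂ₚ (dirDeriv_dirU_zero_flux hG hQ hE hP hPprr)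
  have hEru := congrArg ∂ᵤ (determining_dirU_two hG hQ hE)
  simp only [map_add, map_sub, map_zero, Derivation.leibniz, Derivation.leibniz_pow, smul_eq_mul,
    dirDeriv_comm (dirU 1) dirX, dirDeriv_comm (dirU 1) (dirU 0), hGu, hGp, hPprr, hPpru, hPrru,
    dirDeriv_dirU_jetCoord_self, dirDeriv_dirU_jetCoord_of_ne (by decide : (2 : Fin 3) ≠ 1),
    dirDeriv_dirU_jetCoord_of_ne (by decide : (1 : Fin 3) ≠ 0)] at hQup hEru
  linear_combination hQup - hEru

lemma determining_quadratic_dirU_one (hP : ∂ᵤ P = 0) (hPprr : ∂ₚ (∂ᵣ (∂ᵣ P)) = 0) :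
    3 * ∂ᵣ (∂ᵣ P) * G 2 =
      ∂ₚ (∂ₚ (∂ₚ (∂ₚ P)) - ∂ₓ (∂ₚ (∂ₚ (∂ᵣ P))) - 𝐫 * ∂ₚ (∂ₚ (∂ₚ (∂ᵣ P)))) * G 0 := by
  have hGp (n : ℕ) : ∂ₚ (G n) = 0 := by simp [hG, dirU]
  have hK := congrArg ∂ₚ (determining_quadratic hG hQ hE hP hPprr)
  have h3p : ∂ₚ (3 * 𝐩 : smoothAlg D) = 3 := by
    simp [dirDeriv_ofNat, dirDeriv_dirU_jetCoord_self]
  rw [Derivation.leibniz] at hK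
  simp only [map_add, map_zero, Derivation.leibniz _ (_ * _), Derivation.leibniz _ (∂ₓ _),
    smul_eq_mul, dirDeriv_comm (dirU 1) dirX, h3p, hGp, hPprr] at hK
  linear_combination -hK

end DifferentialConsequences

section RegularJets

variable {g : ℝ → ℝ} {I : Set ℝ} {V : Set (ℝ × (Fin 2 → ℝ))} {Pt Px : ℝ × (Fin 3 → ℝ) → ℝ}
  {z : ℝ × (Fin 3 → ℝ)}

/-- The jet `z` with its coordinate `u` replaced by `v`. -/
def setU (z : ℝ × (Fin 3 → ℝ)) (v : ℝ) : ℝ × (Fin 3 → ℝ) := z + (v - z.2 0) • dirU 0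

lemma setU_snd_zero (z : ℝ × (Fin 3 → ℝ)) (v : ℝ) : (setU z v).2 0 = v := by
  simp [setU, dirU]

lemma add_smul_dirU_zero_mem_nondegenerateJets (hz : z ∈ nondegenerateJets I V) {s : ℝ}
    (hs : z.2 0 + s ∈ I) : z + s • dirU 0 ∈ nondegenerateJets I V := by
  obtain ⟨⟨-, hzV⟩, hp, hr⟩ := hz
  refine ⟨⟨by simpa [dirU] using hs, ?_⟩, by simpa [dirU] using hp, by simpa [dirU] using hr⟩
  convert hzV using 2
  · simp [dirU]
  · simp [dirU]

lemma setU_mem_nondegenerateJets (hz : z ∈ nondegenerateJets I V) {v : ℝ} (hv : v ∈ I) :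
    setU z v ∈ nondegenerateJets I V :=
  add_smul_dirU_zero_mem_nondegenerateJets hz (by rwa [add_sub_cancel])

lemma segment_subset_nondegenerateJets (hI' : I.OrdConnected) (hz : z ∈ nondegenerateJets I V)
    {s : ℝ} (hs : z + s • dirU 0 ∈ nondegenerateJets I V) :
    segment ℝ z (z + s • dirU 0) ⊆ nondegenerateJets I V := by
  have hsI : z.2 0 + s ∈ I := by simpa [dirU] using hs.1.1
  rw [segment_eq_image', add_sub_cancel_left]
  rintro _ ⟨θ, hθ, rfl⟩
  simpa only [smul_smul, smul_eq_mul] using add_smul_dirU_zero_mem_nondegenerateJets hz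
    (hI'.convex.add_smul_mem hz.1.1 hsI hθ)

/-- The nondegenerate jets at which `g` does not vanish. -/
def regularJets (hI : IsOpen I) (hV : IsOpen V) (hg : ContDiffOn ℝ ∞ g I) :
    Opens (ℝ × (Fin 3 → ℝ)) :=
  ⟨nondegenerateJets I V ∩ {z | g (z.2 0) ≠ 0},
    (hg.continuousOn.comp (by fun_prop) fun _ hz => hz.1.1).isOpen_inter_preimage
      (isOpen_nondegenerateJets hI hV) isOpen_compl_singleton⟩

variable (hI : IsOpen I) (hV : IsOpen V) (hg : ContDiffOn ℝ ∞ g I)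

include hI hg in
lemma contDiffOn_iteratedDeriv (n : ℕ) : ContDiffOn ℝ ∞ (iteratedDeriv n g) I := by
  induction n with
  | zero => rwa [iteratedDeriv_zero]
  | succ n ih =>
    rw [iteratedDeriv_succ]
    exact ((contDiffOn_infty_iff_deriv_of_isOpen hI).mp ih).2

/-- The derivative `g⁽ⁿ⁾(u)`, as a function of the jet. -/
def iteratedDerivU (n : ℕ) : smoothAlg (regularJets hI hV hg) :=
  smoothAlg.of (fun z => iteratedDeriv n g (z.2 0))
    ((contDiffOn_iteratedDeriv hI hg n).comp (by fun_prop) fun _ hz => hz.1.1.1)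

lemma dirDeriv_iteratedDerivU (v : ℝ × (Fin 3 → ℝ)) (n : ℕ) :
    dirDeriv v (iteratedDerivU hI hV hg n) = v.2 0 • iteratedDerivU hI hV hg (n + 1) := by
  rw [iteratedDerivU, dirDeriv_of]
  refine Subtype.ext <| funext fun z => ?_
  have hg' := (differentiableAt_of_contDiffOn hI (contDiffOn_iteratedDeriv hI hg n)
    z.2.1.1.1).hasDerivAt
  let L : ℝ × (Fin 3 → ℝ) →L[ℝ] ℝ :=
    (ContinuousLinearMap.proj 0).comp (ContinuousLinearMap.snd ℝ ℝ (Fin 3 → ℝ))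
  have hcomp := (hg'.comp_hasFDerivAt z.1 L.hasFDerivAt).fderiv
  rw [← iteratedDeriv_succ] at hcomp
  exact (congrArg (· v) hcomp).trans (mul_comm _ _)

include hI hg in
lemma iteratedDeriv_eq_of_forall_ne_zero {n : ℕ} {c : ℝ}
    (h : ∀ v ∈ I, g v ≠ 0 → iteratedDeriv n g v = c * g v) :
    ∀ v ∈ I, iteratedDeriv n g v = c * g v := by
  intro v hv
  by_contra hne
  have hcont {f : ℝ → ℝ} (hf : ContDiffOn ℝ ∞ f I) : ContinuousAt f v :=
    hf.continuousOn.continuousAt (hI.mem_nhds hv)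
  have hgv : g =ᶠ[nhds v] 0 := by
    filter_upwards [((hcont (contDiffOn_iteratedDeriv hI hg n)).sub
      (continuousAt_const.mul (hcont hg))).eventually_ne (sub_ne_zero.mpr hne), hI.mem_nhds hv]
      with s hs hsI
    by_contra hgs
    exact hs (sub_eq_zero.mpr (h s hsI hgs))
  exact hne (by simp [hgv.iteratedDeriv_eq, hgv.self_of_nhds])

include hI in
lemma deriv_deriv_eq_of_deriv_eq {k : ℝ} (h : ∀ v ∈ I, deriv g v = k * g v) {v : ℝ} (hv : v ∈ I) :
    deriv (deriv g) v = k ^ 2 * g v := by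
  have hkg : deriv g =ᶠ[nhds v] fun s => k * g s :=
    Filter.eventuallyEq_of_mem (hI.mem_nhds hv) h
  rw [hkg.deriv_eq, deriv_const_mul_field, h v hv, sq, mul_assoc]

variable {hI hV hg} in
lemma exists_iteratedDeriv_eq_of_mul_iteratedDerivU_eq {f h : smoothAlg (regularJets hI hV hg)}
    {n : ℕ} (hf : f ∈ lineInvariants _ (dirU 0)) (hh : h ∈ lineInvariants _ (dirU 0))
    (hfh : f * iteratedDerivU hI hV hg n = h * iteratedDerivU hI hV hg 0)
    {z : regularJets hI hV hg} (hz : f.1 z ≠ 0) :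
    ∃ c, ∀ v ∈ I, iteratedDeriv n g v = c * g v := by
  refine ⟨h.1 z / f.1 z, iteratedDeriv_eq_of_forall_ne_zero hI hg fun v hv hgv => ?_⟩
  let w : regularJets hI hV hg :=
    ⟨setU z v, setU_mem_nondegenerateJets z.2.1 hv, by simpa [setU_snd_zero] using hgv⟩
  have hw : f.1 w * iteratedDeriv n g ((setU z v).2 0) =
      h.1 w * iteratedDeriv 0 g ((setU z v).2 0) := congrFun (congrArg Subtype.val hfh) w
  rw [hf z w _ rfl, hh z w _ rfl, setU_snd_zero, iteratedDeriv_zero] at hw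
  rw [div_mul_eq_mul_div, eq_div_iff hz, mul_comm, hw]

section Law

variable (hlaw : IsConservationLaw g I 2 V Pt Px)

/-- The density of a conservation law, as a smooth function on the regular jets. -/
def IsConservationLaw.density : smoothAlg (regularJets hI hV hg) :=
  smoothAlg.of Pt (hlaw.contDiffOn_Pt.mono fun _ hz => hz.1.1)

/-- The flux of a conservation law, as a smooth function on the regular jets. -/
def IsConservationLaw.flux : smoothAlg (regularJets hI hV hg) :=
  smoothAlg.of Px (hlaw.contDiffOn_Px.mono fun _ hz => hz.1.1)

namespace IsConservationLaw

lemma dirDeriv_dirU_zero_density : dirDeriv (dirU 0) (hlaw.density hI hV hg) = 0 := by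
  rw [density, dirDeriv_of]
  exact Subtype.ext <| funext fun z => (hlaw.determining_equations hI hV hg z.2.1).1

lemma dirDeriv_dirU_two_flux : dirDeriv (dirU 2) (hlaw.flux hI hV hg) = 0 := by
  have hF := two_mul_mul_sq_eq_zero (F := dirDeriv (dirU 2) (hlaw.flux hI hV hg))
    (dirDeriv_iteratedDerivU hI hV hg) <| by
      rw [flux, dirDeriv_of]
      refine Subtype.ext <| funext fun z => ?_
      have hz := (hlaw.determining_equations hI hV hg z.2.1).2.2
      rw [← iteratedDeriv_one] at hz
      exact hz
  refine Subtype.ext <| funext fun z => ?_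
  have hz := congrFun (congrArg Subtype.val hF) z
  have hg₀ : g (z.1.2 0) ≠ 0 := z.2.2
  exact pow_eq_zero_iff two_ne_zero |>.mp
    ((mul_eq_zero.mp hz).resolve_left (mul_ne_zero two_ne_zero hg₀))

lemma determining_equation :
    dirDeriv (dirU 1) (hlaw.density hI hV hg) * iteratedDerivU hI hV hg 0 +
      dirDeriv (dirU 2) (hlaw.density hI hV hg) * jetCoord 1 * iteratedDerivU hI hV hg 1 +
      dirDeriv dirX (hlaw.flux hI hV hg) +
      jetCoord 1 * dirDeriv (dirU 0) (hlaw.flux hI hV hg) +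
      jetCoord 2 * dirDeriv (dirU 1) (hlaw.flux hI hV hg) = 0 := by
  have hQ := hlaw.dirDeriv_dirU_two_flux hI hV hg
  rw [flux, dirDeriv_of] at hQ
  simp only [flux, density, dirDeriv_of]
  refine Subtype.ext <| funext fun z => ?_
  have hQz : fderiv ℝ Px z (dirU 2) = 0 := congrFun (congrArg Subtype.val hQ) z
  have hz := (hlaw.determining_equations hI hV hg z.2.1).2.1
  rw [hQz, mul_zero, add_zero, ← iteratedDeriv_one,
    ← mul_assoc (fderiv ℝ Pt z (dirU 2))] at hz
  exact (mul_eq_zero.mp hz).resolve_right z.2.1.2.1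

include hg in
lemma of_density_mem_lineInvariants (hI' : I.OrdConnected) :
    (smoothAlg.of Pt (hlaw.contDiffOn_Pt.mono fun _ hz => hz.1) :
      smoothAlg ⟨nondegenerateJets I V, isOpen_nondegenerateJets hI hV⟩) ∈
      lineInvariants _ (dirU 0) :=
  of_mem_lineInvariants _ (fun _ hz _ hs => segment_subset_nondegenerateJets hI' hz hs)
    fun _ hz => (hlaw.determining_equations hI hV hg hz).1

lemma density_mem_lineInvariants (hI' : I.OrdConnected) :
    hlaw.density hI hV hg ∈ lineInvariants _ (dirU 0) := fun z w =>
  hlaw.of_density_mem_lineInvariants hI hV hg hI' ⟨z, z.2.1⟩ ⟨w, w.2.1⟩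

lemma exists_dirDeriv_dirDeriv_density_ne_zero (hI' : I.OrdConnected) {v : ℝ} (hv : v ∈ I)
    (hgv : g v ≠ 0) :
    ∃ z, (dirDeriv (dirU 2) (dirDeriv (dirU 2) (hlaw.density hI hV hg))).1 z ≠ 0 := by
  obtain ⟨z, hz, hPrr⟩ := hlaw.exists_mem_nondegenerateJets hI hV
  have hinv := dirDeriv_mem_lineInvariants (dirDeriv_mem_lineInvariants
    (hlaw.of_density_mem_lineInvariants hI hV hg hI') (dirU 2)) (dirU 2)
  rw [dirDeriv_of, dirDeriv_of] at hinv
  have hz' := setU_mem_nondegenerateJets hz hv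
  rw [density, dirDeriv_of, dirDeriv_of]
  exact ⟨⟨setU z v, hz', by simpa [setU_snd_zero] using hgv⟩,
    (hinv ⟨z, hz⟩ ⟨setU z v, hz'⟩ _ rfl).trans_ne hPrr⟩

lemma exists_iteratedDeriv_two_eq_of_eq_zero (hI' : I.OrdConnected)
    (hPprr : dirDeriv (dirU 1)
      (dirDeriv (dirU 2) (dirDeriv (dirU 2) (hlaw.density hI hV hg))) = 0) :
    ∃ c, ∀ v ∈ I, iteratedDeriv 2 g v = c * g v := by
  by_cases hg₀ : ∀ v ∈ I, g v = 0
  · exact ⟨0, iteratedDeriv_eq_of_forall_ne_zero hI hg fun v hv hgv => absurd (hg₀ v hv) hgv⟩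
  push Not at hg₀
  obtain ⟨v, hv, hgv⟩ := hg₀
  obtain ⟨z, hz⟩ := hlaw.exists_dirDeriv_dirDeriv_density_ne_zero hI hV hg hI' hv hgv
  have hP := hlaw.density_mem_lineInvariants hI hV hg hI'
  have hPr := dirDeriv_mem_lineInvariants hP (dirU 2)
  have hder {f : smoothAlg (regularJets hI hV hg)} (hf : f ∈ lineInvariants _ (dirU 0))
      (v : ℝ × (Fin 3 → ℝ)) :
      dirDeriv v (dirDeriv (dirU 1) (dirDeriv (dirU 1) f)) ∈ lineInvariants _ (dirU 0) :=
    dirDeriv_mem_lineInvariants (dirDeriv_mem_lineInvariants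
      (dirDeriv_mem_lineInvariants hf _) _) v
  exact exists_iteratedDeriv_eq_of_mul_iteratedDerivU_eq
    (mul_mem (ofNat_mem _ 3) (dirDeriv_mem_lineInvariants hPr (dirU 2)))
    (dirDeriv_mem_lineInvariants (sub_mem (sub_mem (hder hP _) (hder hPr dirX))
      (mul_mem (jetCoord_mem_lineInvariants (Pi.single_eq_of_ne (by decide) _)) (hder hPr _))) _)
    (determining_quadratic_dirU_one (dirDeriv_iteratedDerivU hI hV hg)
      (hlaw.dirDeriv_dirU_two_flux hI hV hg) (hlaw.determining_equation hI hV hg)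
      (hlaw.dirDeriv_dirU_zero_density hI hV hg) hPprr)
    (z := z) (mul_ne_zero three_ne_zero hz)

lemma exists_iteratedDeriv_one_eq_of_ne_zero (hI' : I.OrdConnected)
    (hPprr : dirDeriv (dirU 1)
      (dirDeriv (dirU 2) (dirDeriv (dirU 2) (hlaw.density hI hV hg))) ≠ 0) :
    ∃ c, ∀ v ∈ I, iteratedDeriv 1 g v = c * g v := by
  obtain ⟨z, hz⟩ := Function.ne_iff.mp (mt Subtype.ext hPprr)
  have hPrr := dirDeriv_mem_lineInvariants (dirDeriv_mem_lineInvariants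
    (hlaw.density_mem_lineInvariants hI hV hg hI') (dirU 2)) (dirU 2)
  have hdet := determining_dirU_two_two (dirDeriv_iteratedDerivU hI hV hg)
    (hlaw.dirDeriv_dirU_two_flux hI hV hg) (hlaw.determining_equation hI hV hg)
  have hf : dirDeriv (dirU 2) (dirDeriv (dirU 2) (dirDeriv (dirU 2) (hlaw.density hI hV hg))) *
      jetCoord 1 * iteratedDerivU hI hV hg 1 = -dirDeriv (dirU 1)
        (dirDeriv (dirU 2) (dirDeriv (dirU 2) (hlaw.density hI hV hg))) *
      iteratedDerivU hI hV hg 0 := by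
    linear_combination hdet
  refine exists_iteratedDeriv_eq_of_mul_iteratedDerivU_eq
    (mul_mem (dirDeriv_mem_lineInvariants hPrr _)
      (jetCoord_mem_lineInvariants (Pi.single_eq_of_ne (by decide) _)))
    (neg_mem (dirDeriv_mem_lineInvariants hPrr _)) hf (z := z) fun hfz => ?_
  have hz' := (congrFun (congrArg Subtype.val hf) z).symm.trans (mul_eq_zero_of_left hfz _)
  exact mul_ne_zero (neg_ne_zero.mpr hz) z.2.2 hz'

include hI hV hg hlaw in
theorem exists_deriv_deriv_eq (hI' : I.OrdConnected) :
    ∃ c, ∀ v ∈ I, deriv (deriv g) v = c * g v := by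
  by_cases hPprr : dirDeriv (dirU 1)
      (dirDeriv (dirU 2) (dirDeriv (dirU 2) (hlaw.density hI hV hg))) = 0
  · simpa only [iteratedDeriv_succ, iteratedDeriv_zero] using
      hlaw.exists_iteratedDeriv_two_eq_of_eq_zero hI hV hg hI' hPprr
  · obtain ⟨k, hk⟩ := hlaw.exists_iteratedDeriv_one_eq_of_ne_zero hI hV hg hI' hPprr
    rw [iteratedDeriv_one] at hk
    exact ⟨k ^ 2, fun v hv => deriv_deriv_eq_of_deriv_eq hI hk hv⟩

end IsConservationLaw

end Law

end RegularJets

end KleinGordon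

end

theorem corollary2p3p2_general (I : Set ℝ) (hI : IsOpen I) (hI' : I.OrdConnected)
    (g : ℝ → ℝ) (hg : ContDiffOn ℝ ∞ g I)
    (hlaw : ∃ V : Set (ℝ × (Fin 2 → ℝ)), IsOpen V ∧
      ∃ Pt Px : ℝ × (Fin 3 → ℝ) → ℝ, KleinGordon.IsConservationLaw g I 2 V Pt Px) :
    ∀ q : ℕ, 1 < q → ∃ Pt Px : ℝ × (Fin (q + 1) → ℝ) → ℝ,
      KleinGordon.IsConservationLaw g I q Set.univ Pt Px := by
  obtain ⟨V, hV, Pt, Px, hPP⟩ := hlaw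
  obtain ⟨c, hc⟩ := hPP.exists_deriv_deriv_eq hI hV hg hI'
  obtain ⟨_, -, ⟨_, _, hw, -⟩, -⟩ := hPP.order
  exact fun q hq => KleinGordon.exists_isConservationLaw (k := c / 4) hI ⟨_, hw.1⟩ hg
    (fun v hv => by rw [hc v hv, mul_div_cancel₀ c four_ne_zero]) hq

theorem corollary2p3p2 (I : Set ℝ) (hI : IsOpen I) (hI' : I.OrdConnected)
    (g : ℝ → ℝ) (hg : ContDiffOn ℝ ∞ g I)
    (hnonlinear : ¬ ∃ a b : ℝ, ∀ u ∈ I, g u = a * u + b)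
    (hlaw : ∃ V : Set (ℝ × (Fin 2 → ℝ)), IsOpen V ∧
      ∃ Pt Px : ℝ × (Fin 3 → ℝ) → ℝ, KleinGordon.IsConservationLaw g I 2 V Pt Px) :
    ∀ q : ℕ, 1 < q → ∃ Pt Px : ℝ × (Fin (q + 1) → ℝ) → ℝ,
      KleinGordon.IsConservationLaw g I q Set.univ Pt Px :=
  corollary2p3p2_general I hI hI' g hg hlaw
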